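/- \textbf{Definitions.} For probability measures $P,Q$ on $\mathbb R^d\times\mathbb R^d$ and $\gamma\ge 1$, let $\mathcal{AW}_\gamma(P,Q)^\gamma=\inf_\pi \mathbb E_\pi\big[|Y-Y'|_2^\gamma+|X-X'|_2^\gamma\big]$, the infimum being over all bi-causal couplings $\pi$ of $P$ and $Q$, i.e. laws of $(X,Y,X',Y')$ with $(X,Y)\sim P$, $(X',Y')\sim Q$, $\mathrm{Law}(Y|X,X')=\mathrm{Law}(Y|X)$ and $\mathrm{Law}(Y'|X,X')=\mathrm{Law}(Y'|X')$. Let $$\mathrm{MPD}(P,\gamma)=\inf\{\mathcal{AW}_\gamma(P,Q)^\gamma:\ Y' \text{ integrable and } \mathbb E[Y'|X']=X' \text{ for }(X',Y')\sim Q\}.$$ For $\sigma>0$ and $\rho>d$ let $f_{\rho,\sigma}(x)=\sigma^{-d}C_\rho(|x|_2/\sigma+1)^{-\rho}$ with $C_\rho^{-1}=\int_{\mathbb R^d}(|x|_2+1)^{-\rho}\,dx$, and let $\xi=\xi_{\rho,\sigma}$ have density $f_{\rho,\sigma}$. The smoothed law $P^{*\xi}$ is the law of $(X+\xi,Y+\xi)$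 for $(X,Y)\sim P$ independent of $\xi$, and $\mathrm{MPD}^{*\xi}_\sigma(P,\gamma)=\mathrm{MPD}(P^{*\xi},\gamma)$. For $\alpha\in(0,1)$ let $c_\alpha(\sigma)$ be the $(1-\alpha)$-quantile $\inf\{c\ge 0:\Pr(\int_{\mathbb R^d}|G_x|_2\,dx\le c)\ge 1-\alpha\}$, where $(G_x)_{x\in\mathbb R^d}$ is a (jointly measurable) centered $\mathbb R^d$-valued Gaussian random field with covariance $\mathbb E[G_xG_y^\top]=\mathbb E_{P_0}[(Y-X)f_{\rho,\sigma}(x-X)f_{\rho,\sigma}(y-X)(Y-X)^\top]$. Given $n$ observations with empirical measure $P_n$, the martingale pair test with bandwidth $\sigma$ and level $\alpha$ rejects the martingale hypothesis if $\sqrt n\,\mathrm{MPD}^{*\xi}_\sigma(P_n,1)>c_\alpha(\sigma)$. \textbf{Statement.} Let $(X_i,Y_i)_{i\ge1}$ be i.i.d. $\mathbb R^d\times\mathbb R^d$-valued random variables with law $P_0$, defined on a probability space $(\Omega,\mathcal F,\mu)$, and $P_n=\frac1n\sum_{i=1}^n\delta_{(X_i,Y_i)}$. Let $\gamma\ge1$,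 $\rho>\gamma+d$, $\tilde\delta>0$, and suppose that $\mathbb E_{P_0}[|(X,Y)|_2^{m+\tilde\delta}]<\infty$, where either (i) $m=2(\gamma+d+\rho(\gamma-1))$, or (ii) $m=2\big(d+1+\rho-\frac{\rho-1}{\gamma}\big)$ and $\rho>\gamma d+1$. If $P_0(\mathbb E[Y|X]\ne X)>0$, then: (a) For every $\sigma>0$ (in particular for $\sigma=1$), $\mathrm{MPD}^{*\xi}_\sigma(P_n,1)\to\mathrm{MPD}^{*\xi}_\sigma(P_0,1)$ $\mu$-almost surely as $n\to\infty$, and $0<\mathrm{MPD}^{*\xi}_\sigma(P_0,1)<\infty$. (b) For every $\alpha\in(0,1)$ and every fixed bandwidth $\sigma>0$, the probability that the test with bandwidth $\sigma$ and level $\alpha$ rejects tends to $1$ as $n\to\infty$. (c) The same holds for the data-driven bandwidth: if $\sigma_n\ge1$ depends on the sample and maximizes $\sigma\mapsto\mathrm{MPD}^{*\xi}_\sigma(P_n,1)$ over $\sigma\ge1$, possibly only up to an error $\varepsilon_n\ge 0$ with $\varepsilon_n\to0$, then for every $\alpha\in(0,1)$ the probability that the test with bandwidth $\sigma_n$ and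 level $\alpha$ rejects tends to $1$. -/

import Mathlib

open MeasureTheory ProbabilityTheory Filter Topology
open scoped ENNReal

noncomputable section

namespace MartingalePair

/-- `ℝ^d` with the Euclidean norm. -/
abbrev E (d : ℕ) : Type := EuclideanSpace ℝ (Fin d)

variable {d : ℕ}

/-- `Q` is the law of a martingale pair `(X', Y')`, i.e. `Y'` is integrable and
`E[Y' | X'] = X'` almost surely. -/
def IsMartingaleLaw (Q : Measure (E d × E d)) : Prop :=
  Integrable Prod.snd Q ∧
    Q[(Prod.snd : E d × E d → E d) |
      MeasurableSpace.comap (Prod.fst : E d × E d → E d) inferInstance] =ᵐ[Q] Prod.fst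

/-- `π` is a bi-causal coupling of `P` and `Q`. A point of the space is written
`((X, Y), (X', Y'))`. The last two fields read `Law(Y | X, X') = Law(Y | X)` and
`Law(Y' | X, X') = Law(Y' | X')`, for regular conditional distributions, almost surely. -/
structure IsBicausal (π : Measure ((E d × E d) × (E d × E d))) [IsFiniteMeasure π]
    (P Q : Measure (E d × E d)) : Prop where
  map_fst : π.map Prod.fst = P
  map_snd : π.map Prod.snd = Q
  causal :
    (fun w => condDistrib (fun v : (E d × E d) × (E d × E d) => v.1.2)
      (fun v => (v.1.1, v.2.1)) π (w.1.1, w.2.1)) =ᵐ[π]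
    fun w => condDistrib (fun v : (E d × E d) × (E d × E d) => v.1.2)
      (fun v => v.1.1) π w.1.1
  anticausal :
    (fun w => condDistrib (fun v : (E d × E d) × (E d × E d) => v.2.2)
      (fun v => (v.1.1, v.2.1)) π (w.1.1, w.2.1)) =ᵐ[π]
    fun w => condDistrib (fun v : (E d × E d) × (E d × E d) => v.2.2)
      (fun v => v.2.1) π w.2.1

/-- The `γ`-th power `AW_γ(P, Q)^γ` of the adapted Wasserstein distance: the infimum of
`E[|Y - Y'|^γ + |X - X'|^γ]` over the bi-causal couplings of `P` and `Q`. -/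
def adaptedWassersteinPow (γ : ℝ) (P Q : Measure (E d × E d)) : ℝ≥0∞ :=
  ⨅ (π : ProbabilityMeasure ((E d × E d) × (E d × E d)))
    (_ : IsBicausal (π : Measure ((E d × E d) × (E d × E d))) P Q),
    ∫⁻ w, (‖w.1.2 - w.2.2‖ₑ ^ γ + ‖w.1.1 - w.2.1‖ₑ ^ γ)
      ∂(π : Measure ((E d × E d) × (E d × E d)))

/-- The martingale projection distance `MPD(P, γ)`. -/
def mpd (P : Measure (E d × E d)) (γ : ℝ) : ℝ≥0∞ :=
  ⨅ (Q : ProbabilityMeasure (E d × E d)) (_ : IsMartingaleLaw (Q : Measure (E d × E d))),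
    adaptedWassersteinPow γ P (Q : Measure (E d × E d))

/-- The density `f_{ξ,ρ,σ}(x) = σ^{-d} C_ρ (|x| / σ + 1)^{-ρ}` on `ℝ^d`, where
`C_ρ⁻¹ = ∫ (|x| + 1)^{-ρ} dx`. For `σ = 1` this is `f_{ξ,ρ}`. -/
def kernelDensity (ρ σ : ℝ) (x : E d) : ℝ :=
  (σ ^ d)⁻¹ * (∫ y : E d, (‖y‖ + 1) ^ (-ρ))⁻¹ * (‖x‖ / σ + 1) ^ (-ρ)

/-- The law of the smoothing variable `ξ` with density `f_{ξ,ρ,σ}`. -/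
def kernelLaw (d : ℕ) (ρ σ : ℝ) : Measure (E d) :=
  volume.withDensity fun x => ENNReal.ofReal (kernelDensity ρ σ x)

/-- The smoothed law `P^{*ξ}`, i.e. the law of `(X + ξ, Y + ξ)` when `(X, Y, ξ)` has law
`P ⊗ Pξ`. -/
def smooth (P : Measure (E d × E d)) (Pξ : Measure (E d)) : Measure (E d × E d) :=
  (P.prod Pξ).map fun v => (v.1.1 + v.2, v.1.2 + v.2)

/-- The smoothed martingale projection distance `MPD^{*ξ}(P, γ)`, where `ξ` has density
`f_{ξ,ρ,σ}`. -/
def smoothedMPD (ρ σ : ℝ) (P : Measure (E d × E d)) (γ : ℝ) : ℝ≥0∞ :=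
  mpd (smooth P (kernelLaw d ρ σ)) γ

/-- The empirical measure `(1/n) ∑_{i < n} δ_{(x i, y i)}`. -/
def empirical (x y : ℕ → E d) (n : ℕ) : Measure (E d × E d) :=
  (n : ℝ≥0∞)⁻¹ • ∑ i ∈ Finset.range n, Measure.dirac (x i, y i)

/-- `G` is a (jointly measurable) centered `ℝ^d`-valued Gaussian random field indexed by `ℝ^d`
with covariance
`E[G_x G_yᵀ] = E[(Y - X) f_{ξ,ρ,σ}(x - X) f_{ξ,ρ,σ}(y - X) (Y - X)ᵀ]`, where `(X, Y)` has
law `P`. -/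
structure IsLimitField (ρ σ : ℝ) (P : Measure (E d × E d)) {Ω : Type} [MeasurableSpace Ω]
    (ν : Measure Ω) (G : E d → Ω → E d) : Prop where
  measurable : Measurable fun p : E d × Ω => G p.1 p.2
  gaussian : IsGaussianProcess G ν
  centered : ∀ x, ∫ ω, G x ω ∂ν = 0
  covariance : ∀ (x y : E d) (j k : Fin d),
    ∫ ω, G x ω j * G y ω k ∂ν =
      ∫ z, (z.2 - z.1) j * kernelDensity ρ σ (x - z.1) *
        kernelDensity ρ σ (y - z.1) * (z.2 - z.1) k ∂P

/-- `L` is the law of `∫ |G_x| dx`, where `G` is the Gaussian field above. -/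
def IsLimitLaw (ρ σ : ℝ) (P : Measure (E d × E d)) (L : Measure ℝ≥0∞) : Prop :=
  ∃ (Ω : Type) (_ : MeasurableSpace Ω) (ν : Measure Ω) (G : E d → Ω → E d),
    IsLimitField ρ σ P ν G ∧ L = ν.map fun ω => ∫⁻ x, ‖G x ω‖ₑ

/-- The critical value at significance level `α`: the `(1 - α)`-quantile
`inf {c ≥ 0 | 1 - α ≤ Prob(∫ |G_x| dx ≤ c)}` of the law of `∫ |G_x| dx` (this law is determined
by the covariance of `G`). -/
def criticalValue (α ρ σ : ℝ) (P : Measure (E d × E d)) : ℝ :=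
  sInf {c : ℝ | 0 ≤ c ∧ ∃ L : Measure ℝ≥0∞, IsLimitLaw ρ σ P L ∧
    ENNReal.ofReal (1 - α) ≤ L (Set.Iic (ENNReal.ofReal c))}

/-- The test with bandwidth `σ` and level `α` rejects when the observed law is `Pn`, based on `n`
observations: `√n MPD^{*ξ}(Pn, 1)` exceeds the critical value. -/
def Rejects (α ρ σ : ℝ) (P₀ : Measure (E d × E d)) (n : ℕ) (Pn : Measure (E d × E d)) : Prop :=
  ENNReal.ofReal (criticalValue α ρ σ P₀) <
    ENNReal.ofReal (Real.sqrt n) * smoothedMPD ρ σ Pn 1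

end MartingalePair

end

open MartingalePair

noncomputable section

namespace MartingalePair

variable {d : ℕ}

/-! Everything rests on an explicit formula at order one. For integrable marginals, MPD(P, 1) =
E|E[Y - X | X]| (`mpd_one_eq`): subtracting the conditional drift from Y while keeping X gives a
martingale pair at this cost, and testing any bi-causal coupling against the unit vector field along
the drift shows that nothing is cheaper. After smoothing, X + ξ has a positive density and the
formula becomes the L¹ norm of N(x) = E[(Y - X) f(x - X)] (`smoothedMPD_one_eq`).

Positivity under the alternative is injectivity of convolution with f. The kernel is a mixture of
centered Gaussians, so its characteristic function never vanishes (`charFun_kernelLaw_ne_zero`). If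
N = 0 almost everywhere, the vector measure A ↦ E[(Y - X); X ∈ A] therefore vanishes, which is the
martingale property.

Almost sure convergence follows from the strong law for N at almost every x. Dominated convergence
with the moving majorants E[|Y - X| f(x - X)] then passes it through the integral; the integral of
such a majorant is E|Y - X|, again covered by the strong law.

For consistency, √n times a quantity with positive limit beats any bounded critical value. With a
data-driven bandwidth, near-maximality compares the statistic with its value at σ = 1, and
`criticalValue_le` bounds the critical values uniformly over σ ≥ 1 by Markov's inequality applied to
∫|G_x| dx. -/

/-! ### The martingale projection distance of order one -/

theorem integral_inner_eq_zero_of_condExp_eq_zero {Ω : Type*} {m mΩ : MeasurableSpace Ω}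
    (hm : m ≤ mΩ) {μ : Measure Ω} [IsFiniteMeasure μ] {φ g : Ω → E d}
    (hφ : StronglyMeasurable[m] φ) (hφ1 : ∀ ω, ‖φ ω‖ ≤ 1) (hg : Integrable g μ)
    (h : μ[g | m] =ᵐ[μ] 0) : ∫ ω, inner ℝ (φ ω) (g ω) ∂μ = 0 := by
  have key := condExp_stronglyMeasurable_bilin_of_bound (μ := μ) (innerSL ℝ) hm hφ hg 1
    (ae_of_all _ hφ1)
  rw [← integral_condExp hm]
  have h2 : μ[fun ω => inner ℝ (φ ω) (g ω) | m] =ᵐ[μ] fun _ => (0 : ℝ) := by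
    refine key.trans ?_
    filter_upwards [h] with ω hω
    simp [hω]
  rw [integral_congr_ae h2]
  simp

theorem condExp_comap_eq_of_setIntegral {Ω : Type*} {mΩ : MeasurableSpace Ω} {μ : Measure Ω}
    [IsFiniteMeasure μ] {f : Ω → E d} {U : Ω → E d} {b : E d → E d} (hf : Integrable f μ)
    (hU : Measurable U) (hb : Measurable b) (hbi : Integrable (fun ω => b (U ω)) μ)
    (h : ∀ A, MeasurableSet A → ∫ ω in U ⁻¹' A, b (U ω) ∂μ = ∫ ω in U ⁻¹' A, f ω ∂μ) :
    μ[f | MeasurableSpace.comap U inferInstance] =ᵐ[μ] fun ω => b (U ω) := by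
  refine (ae_eq_condExp_of_forall_setIntegral_eq hU.comap_le hf (fun s _ _ => hbi.integrableOn)
    ?_ ?_).symm
  · rintro _ ⟨A, hA, rfl⟩ _
    exact h A hA
  · exact ((hb.comp (comap_measurable U)).stronglyMeasurable).aestronglyMeasurable

/-- A second copy of the conditioning variable carries no information, so the kernel that ignores it
is a version of the conditional law. This is what makes a coupling with X = X' bi-causal. -/
theorem condDistrib_prodMk_eq_of_ae_eq {Ω : Type*} {mΩ : MeasurableSpace Ω} {μ : Measure Ω}
    [IsFiniteMeasure μ] {U U' V : Ω → E d} (hU : Measurable U) (hU' : Measurable U')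
    (hV : Measurable V) (h : U =ᵐ[μ] U') :
    (fun ω => condDistrib V (fun ω => (U ω, U' ω)) μ (U ω, U' ω)) =ᵐ[μ]
      fun ω => condDistrib V U μ (U ω) := by
  have key := condDistrib_ae_eq_of_measure_eq_compProd (μ := μ) (fun ω => (U ω, U' ω))
    hV.aemeasurable (κ := (condDistrib V U μ).comap (Prod.fst : E d × E d → E d)
      (measurable_fst : Measurable (Prod.fst : E d × E d → E d))) ?_
  · exact ae_of_ae_map (hU.prodMk hU').aemeasurable key
  · have e1 : μ.map (fun ω => ((U ω, U' ω), V ω))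
        = (μ.map fun ω => (U ω, V ω)).map fun p : E d × E d => ((p.1, p.1), p.2) := by
      rw [Measure.map_map (by fun_prop) (by fun_prop)]
      apply Measure.map_congr
      filter_upwards [h] with ω hω
      simp [hω]
    have e2 : μ.map (fun ω => (U ω, U' ω)) = (μ.map U).map fun p : E d => (p, p) := by
      rw [Measure.map_map (by fun_prop) (by fun_prop)]
      apply Measure.map_congr
      filter_upwards [h] with ω hω
      simp [hω]
    rw [e1, e2, ← compProd_map_condDistrib hV.aemeasurable]
    ext s hs
    have hd : Measurable fun p : E d => (p, p) := by fun_prop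
    have hd2 : Measurable fun p : E d × E d => ((p.1, p.1), p.2) := by fun_prop
    rw [Measure.map_apply hd2 hs, Measure.compProd_apply (hd2 hs), Measure.compProd_apply hs,
      lintegral_map (Kernel.measurable_kernel_prodMk_left hs) hd]
    rfl

/-- Under a bi-causal coupling E[Y' - X' | X, X'] = 0, so Y' - X' can be subtracted from Y - X
inside the pairing with φ(X) at no cost. What remains is bounded by |Y - Y'| + |X - X'|. This is the
duality half of the formula for MPD(P, 1). -/
theorem le_adaptedWassersteinPow_one {P Q : Measure (E d × E d)} [IsProbabilityMeasure P]
    [IsProbabilityMeasure Q]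
    (hX : Integrable Prod.fst P) (hY : Integrable Prod.snd P) (hQ : IsMartingaleLaw Q)
    {φ : E d → E d} (hφ : Measurable φ) (hφ1 : ∀ x, ‖φ x‖ ≤ 1) :
    ENNReal.ofReal (∫ z, inner ℝ (φ z.1) (z.2 - z.1) ∂P) ≤ adaptedWassersteinPow 1 P Q := by
  refine le_iInf₂ fun π hπ => ?_
  set μ : Measure ((E d × E d) × (E d × E d)) := (π : Measure ((E d × E d) × (E d × E d))) with hμ
  obtain ⟨hQ1, hQ2⟩ := hQ
  have hm1 : MeasurePreserving Prod.fst μ P := ⟨measurable_fst, hπ.map_fst⟩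
  have hm2 : MeasurePreserving Prod.snd μ Q := ⟨measurable_snd, hπ.map_snd⟩
  have hX' : Integrable Prod.fst Q := integrable_condExp.congr hQ2
  have i1 : Integrable (fun w => w.1.1) μ := hm1.integrable_comp_of_integrable hX
  have i2 : Integrable (fun w => w.1.2) μ := hm1.integrable_comp_of_integrable hY
  have i3 : Integrable (fun w => w.2.1) μ := hm2.integrable_comp_of_integrable hX'
  have i4 : Integrable (fun w => w.2.2) μ := hm2.integrable_comp_of_integrable hQ1
  have c1 : μ[fun w => w.2.2 | MeasurableSpace.comap (fun w => w.2.1) inferInstance]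
      =ᵐ[μ] fun w => w.2.1 := by
    refine condExp_comap_eq_of_setIntegral (b := id) i4 (by fun_prop) measurable_id i3 ?_
    intro A hA
    have hA' : MeasurableSet ((Prod.fst : E d × E d → E d) ⁻¹' A) := measurable_fst hA
    have e : ((fun w : (E d × E d) × (E d × E d) => w.2.1) ⁻¹' A)
      = Prod.snd ⁻¹' (Prod.fst ⁻¹' A) := rfl
    have a1 := setIntegral_map (μ := μ) (g := Prod.snd) (f := fun z : E d × E d => z.1) hA'
      (by rw [hm2.map_eq]; exact hX'.1) (by fun_prop)
    have a2 := setIntegral_map (μ := μ) (g := Prod.snd) (f := fun z : E d × E d => z.2) hA'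
      (by rw [hm2.map_eq]; exact hQ1.1) (by fun_prop)
    rw [hm2.map_eq] at a1 a2
    simp only [id]
    rw [e, ← a1, ← a2, ← setIntegral_condExp measurable_fst.comap_le hQ1 ⟨A, hA, rfl⟩]
    refine setIntegral_congr_ae hA' ?_
    filter_upwards [hQ2] with z hz _
    rw [hz]
  -- Anticausality enters here: conditioning on X in addition to X' does not change the conditional
  -- mean of Y'.
  have c2 : μ[fun w => w.2.2 |
      MeasurableSpace.comap (fun w => (w.1.1, w.2.1)) inferInstance] =ᵐ[μ] fun w => w.2.1 := by
    have d1 := condExp_ae_eq_integral_condDistrib' (μ := μ) (X := fun w => (w.1.1, w.2.1))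
      (by fun_prop) i4
    have d2 := condExp_ae_eq_integral_condDistrib' (μ := μ) (X := fun w => w.2.1)
      (by fun_prop) i4
    refine d1.trans (EventuallyEq.trans ?_ (d2.symm.trans c1))
    filter_upwards [hπ.anticausal] with w hw
    rw [hw]
  have c3 : ∫ w, inner ℝ (φ w.1.1) (w.2.2 - w.2.1) ∂μ = 0 := by
    have hmeas : Measurable (fun w : (E d × E d) × (E d × E d) => (w.1.1, w.2.1)) := by fun_prop
    refine integral_inner_eq_zero_of_condExp_eq_zero hmeas.comap_le
      ((hφ.comp measurable_fst).comp (comap_measurable _)).stronglyMeasurable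
      (fun _ => hφ1 _) (i4.sub i3) ?_
    have e3 : μ[fun w => w.2.1 |
        MeasurableSpace.comap (fun w => (w.1.1, w.2.1)) inferInstance] = fun w => w.2.1 :=
      condExp_of_stronglyMeasurable hmeas.comap_le
        (measurable_snd.comp (comap_measurable _)).stronglyMeasurable i3
    refine (condExp_sub i4 i3 _).trans ?_
    filter_upwards [c2] with w hw
    simp [hw, e3]
  have bdd : ∀ {g : (E d × E d) × (E d × E d) → E d}, Integrable g μ →
      Integrable (fun w => inner ℝ (φ w.1.1) (g w)) μ := by
    intro g hg
    refine hg.norm.mono (AEStronglyMeasurable.inner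
      (by apply Measurable.aestronglyMeasurable; fun_prop) hg.1) (ae_of_all _ fun w => ?_)
    rw [norm_norm]
    exact (norm_inner_le_norm _ _).trans (mul_le_of_le_one_left (norm_nonneg _) (hφ1 _))
  have j1 : Integrable (fun w => inner ℝ (φ w.1.1) (w.1.2 - w.1.1)) μ :=
    bdd (g := fun w => w.1.2 - w.1.1) (i2.sub i1)
  have j2 : Integrable (fun w => inner ℝ (φ w.1.1) (w.2.2 - w.2.1)) μ :=
    bdd (g := fun w => w.2.2 - w.2.1) (i4.sub i3)
  have c4 : ∫ z, inner ℝ (φ z.1) (z.2 - z.1) ∂P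
      = ∫ w, inner ℝ (φ w.1.1) ((w.1.2 - w.2.2) - (w.1.1 - w.2.1)) ∂μ := by
    have : ∫ z, inner ℝ (φ z.1) (z.2 - z.1) ∂P
        = ∫ w, inner ℝ (φ w.1.1) (w.1.2 - w.1.1) ∂μ := by
      rw [← hm1.map_eq, integral_map (by fun_prop)
        (by apply Measurable.aestronglyMeasurable; fun_prop)]
    rw [this, ← sub_zero (∫ w, inner ℝ (φ w.1.1) (w.1.2 - w.1.1) ∂μ), ← c3,
      ← integral_sub j1 j2]
    refine integral_congr_ae (ae_of_all _ fun w => ?_)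
    simp only [← inner_sub_right]
    congr 1
    abel
  rw [c4]
  refine (ENNReal.ofReal_le_ofReal (le_abs_self _)).trans ?_
  rw [← Real.norm_eq_abs, ofReal_norm]
  refine (enorm_integral_le_lintegral_enorm _).trans (lintegral_mono fun w => ?_)
  simp only [ENNReal.rpow_one]
  rw [← ofReal_norm]
  calc _ ≤ ENNReal.ofReal (‖w.1.2 - w.2.2‖ + ‖w.1.1 - w.2.1‖) :=
        ENNReal.ofReal_le_ofReal <| (norm_inner_le_norm _ _).trans <|
          (mul_le_of_le_one_left (norm_nonneg _) (hφ1 _)).trans (norm_sub_le _ _)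
    _ = _ := by
        rw [ENNReal.ofReal_add (norm_nonneg _) (norm_nonneg _), ofReal_norm, ofReal_norm]

/-- The martingale projection distance of order one is `E|E[Y - X | X]|`. -/
theorem mpd_one_eq {P : Measure (E d × E d)} [IsProbabilityMeasure P]
    (hX : Integrable Prod.fst P) (hY : Integrable Prod.snd P)
    {b : E d → E d} (hb : Measurable b) (hbi : Integrable (fun z => b z.1) P)
    (h : ∀ A, MeasurableSet A →
      ∫ z in Prod.fst ⁻¹' A, b z.1 ∂P = ∫ z in Prod.fst ⁻¹' A, (z.2 - z.1) ∂P) :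
    mpd P 1 = ∫⁻ z, ‖b z.1‖ₑ ∂P := by
  have hcond := condExp_comap_eq_of_setIntegral (U := Prod.fst) (hY.sub hX) measurable_fst hb hbi h
  apply le_antisymm
  -- Upper bound: `b` is a version of the drift E[Y - X | X], so (X, Y - b(X)) is a martingale pair.
  -- Coupled through the same (X, Y), it is at cost |b(X)|.
  · have hT : Measurable fun z : E d × E d => (z.1, z.2 - b z.1) := by fun_prop
    have hS : Measurable fun z : E d × E d => (z, (z.1, z.2 - b z.1)) := by fun_prop
    have hQp : IsProbabilityMeasure (P.map fun z : E d × E d => (z.1, z.2 - b z.1)) :=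
      Measure.isProbabilityMeasure_map hT.aemeasurable
    have hπp : IsProbabilityMeasure (P.map fun z : E d × E d => (z, (z.1, z.2 - b z.1))) :=
      Measure.isProbabilityMeasure_map hS.aemeasurable
    have hmart : IsMartingaleLaw (P.map fun z : E d × E d => (z.1, z.2 - b z.1)) := by
      have j1 : Integrable Prod.snd (P.map fun z : E d × E d => (z.1, z.2 - b z.1)) :=
        (integrable_map_measure (by fun_prop) hT.aemeasurable).2 (hY.sub hbi)
      have j2 : Integrable Prod.fst (P.map fun z : E d × E d => (z.1, z.2 - b z.1)) :=
        (integrable_map_measure (by fun_prop) hT.aemeasurable).2 hX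
      refine ⟨j1, condExp_comap_eq_of_setIntegral (b := id) j1 measurable_fst measurable_id j2 ?_⟩
      intro A hA
      rw [setIntegral_map (measurable_fst hA) (by fun_prop) hT.aemeasurable,
        setIntegral_map (measurable_fst hA) (by fun_prop) hT.aemeasurable]
      have := h A hA
      simp only [id]
      change ∫ z in Prod.fst ⁻¹' A, z.1 ∂P = ∫ z in Prod.fst ⁻¹' A, (z.2 - b z.1) ∂P
      rw [integral_sub hY.integrableOn hbi.integrableOn, this,
        integral_sub hY.integrableOn hX.integrableOn]
      abel
    have hae : (fun v : (E d × E d) × (E d × E d) => v.1.1)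
        =ᵐ[P.map fun z : E d × E d => (z, (z.1, z.2 - b z.1))] fun v => v.2.1 := by
      rw [EventuallyEq, ae_map_iff hS.aemeasurable (measurableSet_eq_fun (by fun_prop)
        (by fun_prop))]
      simp
    have hbc : IsBicausal (P.map fun z : E d × E d => (z, (z.1, z.2 - b z.1))) P
        (P.map fun z : E d × E d => (z.1, z.2 - b z.1)) := by
      constructor
      · rw [Measure.map_map measurable_fst hS]
        exact Measure.map_id
      · rw [Measure.map_map measurable_snd hS]
        rfl
      · exact condDistrib_prodMk_eq_of_ae_eq (by fun_prop) (by fun_prop) (by fun_prop) hae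
      · have key := condDistrib_prodMk_eq_of_ae_eq
          (μ := P.map fun z : E d × E d => (z, (z.1, z.2 - b z.1)))
          (U := fun v => v.1.1) (U' := fun v => v.2.1) (V := fun v => v.2.2)
          (by fun_prop) (by fun_prop) (by fun_prop) hae
        refine key.trans ?_
        filter_upwards [hae] with v hv
        rw [hv, condDistrib_congr_right hae]
    refine (iInf₂_le (⟨_, hQp⟩ : ProbabilityMeasure (E d × E d)) hmart).trans ?_
    refine (iInf₂_le (⟨_, hπp⟩ : ProbabilityMeasure ((E d × E d) × (E d × E d))) hbc).trans ?_
    change ∫⁻ w, _ ∂(P.map fun z : E d × E d => (z, (z.1, z.2 - b z.1))) ≤ _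
    rw [lintegral_map (by fun_prop) hS]
    simp
  · refine le_iInf₂ fun Q hQ => ?_
    -- Lower bound: the extremal test field is the direction of the drift. Where `b` vanishes, `0⁻¹
    -- = 0` makes the field zero, which is harmless.
    have hφ : Measurable fun x => ‖b x‖⁻¹ • b x := by fun_prop
    have hφ1 : ∀ x, ‖‖b x‖⁻¹ • b x‖ ≤ 1 := by
      intro x
      rw [norm_smul, norm_inv, norm_norm]
      exact inv_mul_le_one
    refine le_trans (le_of_eq ?_) (le_adaptedWassersteinPow_one hX hY hQ hφ hφ1)
    have hz : ∫ z, inner ℝ (‖b z.1‖⁻¹ • b z.1) ((z.2 - z.1) - b z.1) ∂P = 0 := by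
      refine integral_inner_eq_zero_of_condExp_eq_zero
        (φ := fun z : E d × E d => ‖b z.1‖⁻¹ • b z.1) measurable_fst.comap_le
        (hφ.comp (comap_measurable _)).stronglyMeasurable (fun _ => hφ1 _)
        ((hY.sub hX).sub hbi) ?_
      refine (condExp_sub (hY.sub hX) hbi _).trans ?_
      have e3 : P[fun z => b z.1 | MeasurableSpace.comap Prod.fst inferInstance]
          = fun z => b z.1 :=
        condExp_of_stronglyMeasurable measurable_fst.comap_le
          (hb.comp (comap_measurable _)).stronglyMeasurable hbi
      filter_upwards [hcond] with z hz
      rw [Pi.sub_apply, hz, e3]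
      simp
    have bdd : ∀ {g : E d × E d → E d}, Integrable g P →
        Integrable (fun z => inner ℝ (‖b z.1‖⁻¹ • b z.1) (g z)) P := by
      intro g hg
      refine hg.norm.mono (AEStronglyMeasurable.inner
        (by apply Measurable.aestronglyMeasurable; fun_prop) hg.1) (ae_of_all _ fun w => ?_)
      rw [norm_norm]
      exact (norm_inner_le_norm _ _).trans (mul_le_of_le_one_left (norm_nonneg _) (hφ1 _))
    simp only [inner_sub_right (𝕜 := ℝ) _ (_ - _) (b _)] at hz
    rw [integral_sub (f := fun z : E d × E d => inner ℝ (‖b z.1‖⁻¹ • b z.1) (z.2 - z.1))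
      (bdd (hY.sub hX)) (bdd hbi), sub_eq_zero] at hz
    rw [hz, ← ofReal_integral_norm_eq_lintegral_enorm hbi]
    congr 1
    refine integral_congr_ae (ae_of_all _ fun z => ?_)
    simp only [real_inner_smul_left, real_inner_self_eq_norm_sq]
    rcases eq_or_ne ‖b z.1‖ 0 with h0 | h0
    · simp [h0]
    · field_simp

/-! ### The smoothing kernel: positivity, mass one, first moment -/

section Kernel

variable {ρ σ : ℝ}

theorem integrable_norm_add_one_rpow (hρ : (d : ℝ) < ρ) :
    Integrable (fun y : E d => (‖y‖ + 1) ^ (-ρ)) := by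
  have := integrable_one_add_norm (E := E d) (μ := volume) (r := ρ) (by simpa using hρ)
  simpa only [add_comm] using this

theorem integral_norm_add_one_rpow_pos (hρ : (d : ℝ) < ρ) :
    0 < ∫ y : E d, (‖y‖ + 1) ^ (-ρ) := by
  rw [integral_pos_iff_support_of_nonneg (fun y => by positivity)
    (integrable_norm_add_one_rpow hρ)]
  have : Function.support (fun y : E d => (‖y‖ + 1) ^ (-ρ)) = Set.univ :=
    Set.eq_univ_of_forall fun y => (by positivity : (0 : ℝ) < (‖y‖ + 1) ^ (-ρ)).ne'
  rw [this]
  exact isOpen_univ.measure_pos _ Set.univ_nonempty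

theorem kernelDensity_nonneg (hσ : 0 < σ) (x : E d) : 0 ≤ kernelDensity ρ σ x := by
  have : 0 ≤ ∫ y : E d, (‖y‖ + 1) ^ (-ρ) := integral_nonneg fun y => by positivity
  unfold kernelDensity
  positivity

theorem kernelDensity_pos (hρ : (d : ℝ) < ρ) (hσ : 0 < σ) (x : E d) :
    0 < kernelDensity ρ σ x := by
  have := integral_norm_add_one_rpow_pos hρ
  unfold kernelDensity
  positivity

theorem continuous_kernelDensity (hσ : 0 < σ) :
    Continuous (kernelDensity ρ σ : E d → ℝ) := by
  unfold kernelDensity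
  refine continuous_const.mul (Continuous.rpow_const (by fun_prop) fun x => Or.inl ?_)
  positivity

theorem kernelDensity_le (hρ : (d : ℝ) < ρ) (hσ : 0 < σ) (x : E d) :
    kernelDensity ρ σ x ≤ (σ ^ d)⁻¹ * (∫ y : E d, (‖y‖ + 1) ^ (-ρ))⁻¹ := by
  have := integral_norm_add_one_rpow_pos hρ
  unfold kernelDensity
  refine mul_le_of_le_one_right (by positivity) ?_
  refine Real.rpow_le_one_of_one_le_of_nonpos ?_ ?_
  · simp only [le_add_iff_nonneg_left]; positivity
  · have : (0 : ℝ) ≤ d := by positivity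
    linarith

theorem kernelDensity_eq_smul (hσ : 0 < σ) (x : E d) :
    kernelDensity ρ σ x = (σ ^ d)⁻¹ * (∫ y : E d, (‖y‖ + 1) ^ (-ρ))⁻¹ *
      (‖σ⁻¹ • x‖ + 1) ^ (-ρ) := by
  rw [kernelDensity, norm_smul, norm_inv, Real.norm_of_nonneg hσ.le, div_eq_inv_mul]

theorem integrable_kernelDensity (hρ : (d : ℝ) < ρ) (hσ : 0 < σ) :
    Integrable (kernelDensity ρ σ : E d → ℝ) := by
  have h := (integrable_norm_add_one_rpow hρ).comp_smul (inv_ne_zero hσ.ne')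
  exact (h.const_mul _).congr (ae_of_all _ fun x => (kernelDensity_eq_smul hσ x).symm)

theorem integral_kernelDensity (hρ : (d : ℝ) < ρ) (hσ : 0 < σ) :
    ∫ x : E d, kernelDensity ρ σ x = 1 := by
  simp_rw [kernelDensity_eq_smul hσ]
  rw [integral_const_mul,
    Measure.integral_comp_smul volume (fun y : E d => (‖y‖ + 1) ^ (-ρ)) σ⁻¹]
  have := integral_norm_add_one_rpow_pos hρ
  simp only [finrank_euclideanSpace, Fintype.card_fin, inv_pow, inv_inv, smul_eq_mul]
  rw [abs_of_pos (by positivity)]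
  field_simp

/-- One power of the norm lowers the decay exponent from ρ to ρ - 1, which must still exceed d. The
resulting first moment of ξ keeps the smoothed pair integrable. -/
theorem integrable_norm_mul_kernelDensity (hρ : (d : ℝ) + 1 < ρ) (hσ : 0 < σ) :
    Integrable (fun x : E d => kernelDensity ρ σ x * ‖x‖) := by
  have h := ((integrable_norm_add_one_rpow (d := d) (ρ := ρ - 1) (by linarith)).comp_smul
    (inv_ne_zero hσ.ne')).const_mul ((σ ^ d)⁻¹ * (∫ y : E d, (‖y‖ + 1) ^ (-ρ))⁻¹ * σ)
  refine h.mono ((continuous_kernelDensity hσ).mul continuous_norm).aestronglyMeasurable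
    (ae_of_all _ fun x => ?_)
  have hC := integral_norm_add_one_rpow_pos (d := d) (ρ := ρ) (by linarith)
  rw [kernelDensity_eq_smul hσ]
  have hx : ‖x‖ = σ * ‖σ⁻¹ • x‖ := by
    rw [norm_smul, norm_inv, Real.norm_of_nonneg hσ.le]
    field_simp
  generalize ∫ y : E d, (‖y‖ + 1) ^ (-ρ) = K at hC ⊢
  have hy0 : 0 ≤ ‖σ⁻¹ • x‖ := norm_nonneg _
  generalize ‖σ⁻¹ • x‖ = y at hx hy0 ⊢
  rw [Real.norm_of_nonneg (by positivity), Real.norm_of_nonneg (by positivity)]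
  rw [hx]
  have e : (y + 1) ^ (-(ρ - 1)) = (y + 1) ^ (-ρ) * (y + 1) := by
    rw [← Real.rpow_add_one (by positivity)]
    ring_nf
  rw [e]
  have h0 : 0 ≤ (σ ^ d)⁻¹ * K⁻¹ * σ * (y + 1) ^ (-ρ) := by positivity
  calc _ = (σ ^ d)⁻¹ * K⁻¹ * σ * (y + 1) ^ (-ρ) * y := by ring
    _ ≤ (σ ^ d)⁻¹ * K⁻¹ * σ * (y + 1) ^ (-ρ) * (y + 1) := by gcongr; linarith
    _ = _ := by ring

theorem isProbabilityMeasure_kernelLaw (hρ : (d : ℝ) < ρ) (hσ : 0 < σ) :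
    IsProbabilityMeasure (kernelLaw d ρ σ) := by
  refine ⟨?_⟩
  rw [kernelLaw, withDensity_apply _ MeasurableSet.univ, setLIntegral_univ,
    ← ofReal_integral_eq_lintegral_ofReal (integrable_kernelDensity hρ hσ)
      (ae_of_all _ (kernelDensity_nonneg hσ)), integral_kernelDensity hρ hσ, ENNReal.ofReal_one]

theorem integrable_id_kernelLaw (hρ : (d : ℝ) + 1 < ρ) (hσ : 0 < σ) :
    Integrable (fun x => x) (kernelLaw d ρ σ) := by
  rw [kernelLaw, integrable_withDensity_iff_integrable_smul₀'
    ((continuous_kernelDensity hσ).measurable.ennreal_ofReal.aemeasurable)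
    (ae_of_all _ fun _ => ENNReal.ofReal_lt_top)]
  refine (integrable_norm_mul_kernelDensity hρ hσ).mono ?_ (ae_of_all _ fun x => ?_)
  · have := (continuous_kernelDensity (d := d) (ρ := ρ) hσ).measurable
    apply Measurable.aestronglyMeasurable
    fun_prop
  · rw [ENNReal.toReal_ofReal (kernelDensity_nonneg hσ x), norm_smul, norm_mul, norm_norm]

end Kernel

/-! ### The smoothed distance as the L¹ norm of the smoothed drift -/

section Drift

variable {ρ σ : ℝ}

/-- `x ↦ E[(Y - X) f_{ξ,ρ,σ}(x - X)]`, the density of the drift of the smoothed pair. -/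
def smoothedDrift (ρ σ : ℝ) (P : Measure (E d × E d)) (x : E d) : E d :=
  ∫ z, kernelDensity ρ σ (x - z.1) • (z.2 - z.1) ∂P

theorem measurable_kernelDensity_sub (hσ : 0 < σ) :
    Measurable fun p : (E d × E d) × E d => kernelDensity ρ σ (p.2 - p.1.1) :=
  (continuous_kernelDensity hσ).measurable.comp (by fun_prop)

theorem stronglyMeasurable_smoothedDrift (hσ : 0 < σ) (P : Measure (E d × E d)) [SFinite P] :
    StronglyMeasurable (smoothedDrift ρ σ P) := by
  have h := measurable_kernelDensity_sub (d := d) (ρ := ρ) hσ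
  have : StronglyMeasurable fun p : (E d × E d) × E d =>
      kernelDensity ρ σ (p.2 - p.1.1) • (p.1.2 - p.1.1) :=
    Measurable.stronglyMeasurable (by fun_prop)
  exact this.integral_prod_left'

theorem integrable_kernelDensity_smul_prod (hρ : (d : ℝ) < ρ) (hσ : 0 < σ)
    {P : Measure (E d × E d)} [IsProbabilityMeasure P]
    {F : Type*} [NormedAddCommGroup F] [NormedSpace ℝ F] {g : E d × E d → F} (hg : Integrable g P) :
    Integrable (fun p : (E d × E d) × E d => kernelDensity ρ σ (p.2 - p.1.1) • g p.1)
      (P.prod volume) := by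
  have h := measurable_kernelDensity_sub (d := d) (ρ := ρ) hσ
  have hm : AEStronglyMeasurable (fun p : (E d × E d) × E d =>
      kernelDensity ρ σ (p.2 - p.1.1) • g p.1) (P.prod volume) :=
    h.aestronglyMeasurable.smul hg.1.comp_fst
  rw [integrable_prod_iff hm]
  refine ⟨ae_of_all _ fun z => ((integrable_kernelDensity hρ hσ).comp_sub_right z.1).smul_const (g z),
    ?_⟩
  have e : ∀ z : E d × E d, ∫ x, ‖kernelDensity ρ σ (x - z.1) • g z‖ = ‖g z‖ := by
    intro z
    simp_rw [norm_smul, Real.norm_of_nonneg (kernelDensity_nonneg hσ _)]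
    rw [integral_mul_const, integral_sub_right_eq_self (kernelDensity ρ σ) z.1,
      integral_kernelDensity hρ hσ, one_mul]
  simp_rw [e]
  exact hg.norm

/-- Substituting x = X + ξ makes the first smoothed coordinate the Lebesgue variable, so that
conditioning on it reduces to Fubini. -/
theorem smooth_eq_map_withDensity (hρ : (d : ℝ) < ρ) (hσ : 0 < σ) (P : Measure (E d × E d))
    [IsProbabilityMeasure P] :
    smooth P (kernelLaw d ρ σ) =
      ((P.prod volume).withDensity fun p =>
        ENNReal.ofReal (kernelDensity ρ σ (p.2 - p.1.1))).map
        fun p => (p.2, p.1.2 + (p.2 - p.1.1)) := by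
  have := isProbabilityMeasure_kernelLaw (d := d) hρ hσ
  have hf := measurable_kernelDensity_sub (d := d) (ρ := ρ) hσ
  have hf' := (continuous_kernelDensity (d := d) (ρ := ρ) hσ).measurable
  refine Measure.ext_of_lintegral _ fun g hg => ?_
  rw [smooth, lintegral_map hg (by fun_prop), lintegral_map hg (by fun_prop),
    lintegral_withDensity_eq_lintegral_mul _ (by fun_prop) (by fun_prop),
    lintegral_prod _ (by fun_prop), lintegral_prod _ (by fun_prop)]
  refine lintegral_congr fun z => ?_
  rw [kernelLaw, lintegral_withDensity_eq_lintegral_mul _ (by fun_prop) (by fun_prop),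
    ← lintegral_sub_right_eq_self _ z.1]
  refine lintegral_congr fun x => ?_
  simp

theorem lintegral_enorm_smoothedDrift_lt_top (hρ : (d : ℝ) < ρ) (hσ : 0 < σ)
    {P : Measure (E d × E d)} [IsProbabilityMeasure P]
    (hX : Integrable Prod.fst P) (hY : Integrable Prod.snd P) :
    ∫⁻ x, ‖smoothedDrift ρ σ P x‖ₑ < ⊤ :=
  (integrable_kernelDensity_smul_prod hρ hσ (hY.sub hX)).integral_prod_right.2

/-- The smoothed martingale projection distance of order one is the `L¹` norm of the smoothed
drift. -/
theorem smoothedMPD_one_eq (hρ : (d : ℝ) + 1 < ρ) (hσ : 0 < σ)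
    {P : Measure (E d × E d)} [IsProbabilityMeasure P]
    (hX : Integrable Prod.fst P) (hY : Integrable Prod.snd P) :
    smoothedMPD ρ σ P 1 = ∫⁻ x, ‖smoothedDrift ρ σ P x‖ₑ := by
  have hρ' : (d : ℝ) < ρ := by linarith
  have hκ := isProbabilityMeasure_kernelLaw (d := d) hρ' hσ
  have hf := measurable_kernelDensity_sub (d := d) (ρ := ρ) hσ
  have hN := (stronglyMeasurable_smoothedDrift (ρ := ρ) hσ P).measurable
  -- `D` is the density of X + ξ, everywhere positive because the kernel is. The noise cancels in (Y
  -- + ξ) - (X + ξ), so the drift given X + ξ = x is the quotient `b` defined below, and the weight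
  -- `D` cancels its denominator in E|b(X + ξ)|.
  set D : E d → ℝ := fun x => ∫ z, kernelDensity ρ σ (x - z.1) ∂P with hD
  have hfi : ∀ x : E d, Integrable (fun z : E d × E d => kernelDensity ρ σ (x - z.1)) P := by
    intro x
    refine Integrable.of_bound (C := (σ ^ d)⁻¹ * (∫ y : E d, (‖y‖ + 1) ^ (-ρ))⁻¹)
      ((continuous_kernelDensity hσ).comp (by fun_prop)).aestronglyMeasurable
      (ae_of_all _ fun z => ?_)
    rw [Real.norm_of_nonneg (kernelDensity_nonneg hσ _)]
    exact kernelDensity_le hρ' hσ _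
  have hDm : Measurable D :=
    (hf.stronglyMeasurable.integral_prod_left' (μ := P)).measurable
  have hDpos : ∀ x, 0 < D x := by
    intro x
    rw [hD, integral_pos_iff_support_of_nonneg (fun z => kernelDensity_nonneg hσ _) (hfi x)]
    have : Function.support (fun z : E d × E d => kernelDensity ρ σ (x - z.1)) = Set.univ :=
      Set.eq_univ_of_forall fun y => (kernelDensity_pos hρ' hσ _).ne'
    rw [this]
    simp
  set b : E d → E d := fun x => (D x)⁻¹ • smoothedDrift ρ σ P x with hb
  have hbm : Measurable b := by fun_prop
  have hDb : ∀ x, D x • b x = smoothedDrift ρ σ P x := fun x => by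
    rw [hb, smul_smul, mul_inv_cancel₀ (hDpos x).ne', one_smul]
  have hT : Measurable fun v : (E d × E d) × E d => (v.1.1 + v.2, v.1.2 + v.2) := by fun_prop
  have hT' : Measurable fun p : (E d × E d) × E d => (p.2, p.1.2 + (p.2 - p.1.1)) := by fun_prop
  have hS : IsProbabilityMeasure (smooth P (kernelLaw d ρ σ)) :=
    Measure.isProbabilityMeasure_map hT.aemeasurable
  have hid := integrable_id_kernelLaw (d := d) hρ hσ
  have iX : Integrable Prod.fst (smooth P (kernelLaw d ρ σ)) :=
    (integrable_map_measure (by fun_prop) hT.aemeasurable).2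
      ((hX.comp_fst _).add (hid.comp_snd _))
  have iY : Integrable Prod.snd (smooth P (kernelLaw d ρ σ)) :=
    (integrable_map_measure (by fun_prop) hT.aemeasurable).2
      ((hY.comp_fst _).add (hid.comp_snd _))
  have key : ∫⁻ z, ‖b z.1‖ₑ ∂(smooth P (kernelLaw d ρ σ))
      = ∫⁻ x, ‖smoothedDrift ρ σ P x‖ₑ := by
    rw [smooth_eq_map_withDensity hρ' hσ, lintegral_map (by fun_prop) hT',
      lintegral_withDensity_eq_lintegral_mul _ (by fun_prop) (by fun_prop),
      lintegral_prod_symm _ (by fun_prop)]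
    refine lintegral_congr fun x => ?_
    simp only [Pi.mul_apply]
    rw [lintegral_mul_const _ (f := fun z : E d × E d => ENNReal.ofReal (kernelDensity ρ σ (x - z.1)))
      (hf.comp measurable_prodMk_right).ennreal_ofReal, ← ofReal_integral_eq_lintegral_ofReal (hfi x)
      (ae_of_all _ fun z => kernelDensity_nonneg hσ _), ← hDb x,
      enorm_smul (D x) (b x), Real.enorm_of_nonneg (hDpos x).le]
  have ib : Integrable (fun z => b z.1) (smooth P (kernelLaw d ρ σ)) := by
    refine ⟨by apply Measurable.aestronglyMeasurable; fun_prop, ?_⟩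
    rw [hasFiniteIntegral_iff_enorm, key]
    exact lintegral_enorm_smoothedDrift_lt_top hρ' hσ hX hY
  rw [smoothedMPD, mpd_one_eq iX iY hbm ib, key]
  intro A hA
  -- Integrals over the event X + ξ ∈ A are computed with x outermost. Applied to b(x) and to Y - X,
  -- this reduces the defining property of the conditional drift to a pointwise identity in x.
  have fub : ∀ g : (E d × E d) × E d → E d, Measurable g →
      Integrable (fun p => kernelDensity ρ σ (p.2 - p.1.1) • g p) (P.prod volume) →
      ∫ p in Prod.snd ⁻¹' A, g p ∂((P.prod volume).withDensity fun p =>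
        ENNReal.ofReal (kernelDensity ρ σ (p.2 - p.1.1)))
      = ∫ x in A, ∫ z, kernelDensity ρ σ (x - z.1) • g (z, x) ∂P := by
    intro g hg hgi
    rw [setIntegral_withDensity_eq_setIntegral_toReal_smul hf.ennreal_ofReal
      (ae_of_all _ fun _ => ENNReal.ofReal_lt_top) _ (measurable_snd hA)]
    simp_rw [ENNReal.toReal_ofReal (kernelDensity_nonneg hσ _)]
    have : (Prod.snd : (E d × E d) × E d → E d) ⁻¹' A = Set.univ ×ˢ A := by ext; simp
    rw [this, ← Measure.prod_restrict, Measure.restrict_univ, integral_prod_symm]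
    rw [← Measure.restrict_univ (μ := P), Measure.prod_restrict]
    exact hgi.integrableOn
  rw [smooth_eq_map_withDensity hρ' hσ] at ib ⊢
  rw [setIntegral_map (measurable_fst hA) (by apply Measurable.aestronglyMeasurable; fun_prop)
      hT'.aemeasurable, setIntegral_map (measurable_fst hA) (by fun_prop) hT'.aemeasurable]
  have e1 := fub (fun p => b p.2) (by fun_prop) (by
    have := (integrable_map_measure (by apply Measurable.aestronglyMeasurable; fun_prop)
      hT'.aemeasurable).1 ib
    rw [integrable_withDensity_iff_integrable_smul₀' hf.ennreal_ofReal.aemeasurable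
      (ae_of_all _ fun _ => ENNReal.ofReal_lt_top)] at this
    refine this.congr (ae_of_all _ fun p => ?_)
    simp [ENNReal.toReal_ofReal (kernelDensity_nonneg hσ _)])
  have e2 := fub (fun p => p.1.2 + (p.2 - p.1.1) - p.2) (by fun_prop) (by
    refine (integrable_kernelDensity_smul_prod hρ' hσ (hY.sub hX)).congr (ae_of_all _ fun p => ?_)
    simp only [Pi.sub_apply]
    congr 1
    abel)
  refine e1.trans (Eq.trans ?_ e2.symm)
  refine setIntegral_congr_fun hA fun x _ => ?_
  simp only
  rw [integral_smul_const]
  refine (hDb x).trans ?_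
  rw [smoothedDrift]
  congr 1
  funext z
  congr 1
  abel

end Drift

/-! ### The kernel as a mixture of Gaussians -/

section GaussianMixture

open Real Set

/-- Cauchy–Schlömilch substitution: w = v - b/v maps (0, ∞) bijectively onto ℝ with derivative 1 +
b/v², so the integral with this weight is the full Gaussian integral √π. The involution v ↦ b/v
shows that the parts with weights 1 and b/v² are equal, so each is half of it. -/
theorem integral_exp_neg_sub_div_sq {b : ℝ} (hb : 0 < b) :
    IntegrableOn (fun v : ℝ => exp (-(v - b / v) ^ 2)) (Ioi 0) ∧
      ∫ v in Ioi (0 : ℝ), exp (-(v - b / v) ^ 2) = √π / 2 := by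
  set G : ℝ → ℝ := fun v => exp (-(v - b / v) ^ 2) with hG
  have hd : ∀ v ∈ Ioi (0 : ℝ),
      HasDerivWithinAt (fun v : ℝ => v - b / v) (1 + b / v ^ 2) (Ioi 0) v := by
    intro v hv
    have hv0 : v ≠ 0 := (mem_Ioi.1 hv).ne'
    refine HasDerivAt.hasDerivWithinAt ?_
    have := (hasDerivAt_id v).sub ((hasDerivAt_const v b).div (hasDerivAt_id v) hv0)
    refine this.congr_deriv ?_
    simp
    ring
  have hinj : InjOn (fun v : ℝ => v - b / v) (Ioi 0) := by
    have : StrictMonoOn (fun v : ℝ => v - b / v) (Ioi 0) := by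
      intro x hx y _ hxy
      have : b / y < b / x := div_lt_div_of_pos_left hb hx hxy
      simp only
      linarith
    exact this.injOn
  have himg : (fun v : ℝ => v - b / v) '' Ioi 0 = univ := by
    refine eq_univ_of_forall fun w => ?_
    have hs : w ^ 2 < w ^ 2 + 4 * b := by linarith
    have h1 : |w| < √(w ^ 2 + 4 * b) := by
      rw [← sqrt_sq_eq_abs]
      exact sqrt_lt_sqrt (sq_nonneg _) hs
    have h2 : 0 < (w + √(w ^ 2 + 4 * b)) / 2 := by linarith [neg_abs_le w]
    -- The positive root of v² - w v - b = 0.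
    refine ⟨(w + √(w ^ 2 + 4 * b)) / 2, h2, ?_⟩
    have h3 : √(w ^ 2 + 4 * b) ^ 2 = w ^ 2 + 4 * b := sq_sqrt (by positivity)
    simp only
    generalize √(w ^ 2 + 4 * b) = r at h2 h3 ⊢
    have h4 : w + r ≠ 0 := by intro h; rw [h] at h2; simp at h2
    field_simp
    linarith
  have hdk : ∀ v ∈ Ioi (0 : ℝ), HasDerivWithinAt (fun v : ℝ => b / v) (-(b / v ^ 2)) (Ioi 0) v := by
    intro v hv
    have hv0 : v ≠ 0 := (mem_Ioi.1 hv).ne'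
    refine HasDerivAt.hasDerivWithinAt ?_
    refine ((hasDerivAt_const v b).div (hasDerivAt_id v) hv0).congr_deriv ?_
    simp
    ring
  have hinjk : InjOn (fun v : ℝ => b / v) (Ioi 0) := by
    intro x hx y hy hxy
    have hx0 : x ≠ 0 := (mem_Ioi.1 hx).ne'
    have hy0 : y ≠ 0 := (mem_Ioi.1 hy).ne'
    simp only at hxy
    field_simp at hxy
    exact hxy.symm
  have himgk : (fun v : ℝ => b / v) '' Ioi 0 = Ioi 0 := by
    ext w
    constructor
    · rintro ⟨v, hv, rfl⟩
      exact div_pos hb hv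
    · intro hw
      refine ⟨b / w, div_pos hb hw, ?_⟩
      have hw0 : w ≠ 0 := (mem_Ioi.1 hw).ne'
      simp only
      field_simp
  have hgauss : Integrable fun w : ℝ => exp (-w ^ 2) := by
    simpa using integrable_exp_neg_mul_sq (b := 1) one_pos
  have i1 : IntegrableOn (fun v => |1 + b / v ^ 2| • G v) (Ioi 0) := by
    rw [← integrableOn_image_iff_integrableOn_abs_deriv_smul measurableSet_Ioi hd hinj
      (fun w => exp (-w ^ 2)), himg]
    exact hgauss.integrableOn
  have e1 : ∫ v in Ioi (0 : ℝ), |1 + b / v ^ 2| • G v = √π := by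
    rw [← integral_image_eq_integral_abs_deriv_smul measurableSet_Ioi hd hinj
      (fun w => exp (-w ^ 2)), himg, setIntegral_univ]
    simpa using integral_gaussian 1
  have e2 : ∫ v in Ioi (0 : ℝ), G v = ∫ v in Ioi (0 : ℝ), |-(b / v ^ 2)| • G v := by
    have := integral_image_eq_integral_abs_deriv_smul measurableSet_Ioi hdk hinjk G
    rw [himgk] at this
    rw [this]
    refine setIntegral_congr_fun measurableSet_Ioi fun v hv => ?_
    have hv0 : v ≠ 0 := (mem_Ioi.1 hv).ne'
    simp only [hG]
    congr 3
    field_simp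
    ring
  have hGm : Measurable G := by fun_prop
  have i2 : IntegrableOn G (Ioi 0) := by
    refine Integrable.mono i1 hGm.aestronglyMeasurable ?_
    refine (ae_restrict_iff' measurableSet_Ioi).2 (ae_of_all _ fun v _ => ?_)
    rw [norm_smul, norm_eq_abs |1 + b / v ^ 2|, abs_abs, abs_of_pos (by positivity)]
    exact le_mul_of_one_le_left (norm_nonneg _) (by simp; positivity)
  have i3 : IntegrableOn (fun v => |-(b / v ^ 2)| • G v) (Ioi 0) := by
    refine (i1.sub i2).congr (ae_of_all _ fun v => ?_)
    have h0 : 0 ≤ b / v ^ 2 := by positivity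
    simp only [Pi.sub_apply, smul_eq_mul]
    rw [abs_neg, abs_of_nonneg h0, abs_of_pos (by positivity)]
    ring
  refine ⟨i2, ?_⟩
  have e3 : ∫ v in Ioi (0 : ℝ), |1 + b / v ^ 2| • G v
      = (∫ v in Ioi (0 : ℝ), G v) + ∫ v in Ioi (0 : ℝ), |-(b / v ^ 2)| • G v := by
    rw [← integral_add i2 i3]
    refine integral_congr_ae (ae_of_all _ fun v => ?_)
    have h0 : 0 ≤ b / v ^ 2 := by positivity
    simp only [smul_eq_mul]
    rw [abs_neg, abs_of_nonneg h0, abs_of_pos (by positivity)]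
    ring
  rw [e1, ← e2] at e3
  linarith

/-- Completing the square gives v² + a²/(4v²) = (v - a/(2v))² + a, which reduces the claim to the
preceding substitution with b = a/2. The case a = 0 is separate because that substitution needs b >
0. -/
theorem exp_neg_eq_integral_gaussian {a : ℝ} (ha : 0 ≤ a) :
    IntegrableOn (fun v : ℝ => exp (-v ^ 2) * exp (-(a ^ 2 / (4 * v ^ 2)))) (Ioi 0) ∧
      ∫ v in Ioi (0 : ℝ), exp (-v ^ 2) * exp (-(a ^ 2 / (4 * v ^ 2))) = √π / 2 * exp (-a) := by
  rcases ha.eq_or_lt with rfl | ha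
  · have h1 := (integrable_exp_neg_mul_sq (b := 1) one_pos).integrableOn (s := Ioi 0)
    have h2 := integral_gaussian_Ioi 1
    simp only [neg_mul, one_mul, div_one] at h1 h2
    refine ⟨by simpa using h1, by simpa using h2⟩
  · obtain ⟨h1, h2⟩ := integral_exp_neg_sub_div_sq (half_pos ha)
    have e : EqOn (fun v : ℝ => exp (-v ^ 2) * exp (-(a ^ 2 / (4 * v ^ 2))))
        (fun v => exp (-(v - a / 2 / v) ^ 2) * exp (-a)) (Ioi 0) := by
      intro v hv
      have hv0 : v ≠ 0 := (mem_Ioi.1 hv).ne'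
      simp only
      rw [← exp_add, ← exp_add]
      congr 1
      field_simp
      ring
    refine ⟨IntegrableOn.congr_fun (Integrable.mul_const h1 _) e.symm measurableSet_Ioi, ?_⟩
    rw [setIntegral_congr_fun measurableSet_Ioi e, integral_mul_const, h2]

/-- The Gamma integral writes (r + 1)^(-ρ) as a mixture over t of e^(-t) e^(-tr), and each e^(-tr)
is in turn a mixture over v of functions Gaussian in r. Here τ = (t, v). -/
theorem rpow_neg_add_one_eq_integral_gaussian {ρ r : ℝ} (hρ : 0 < ρ) (hr : 0 ≤ r) :
    Integrable (fun τ : ℝ × ℝ => τ.1 ^ (ρ - 1) * exp (-τ.1) * exp (-τ.2 ^ 2) *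
        exp (-((τ.1 * r) ^ 2 / (4 * τ.2 ^ 2))))
      ((volume.restrict (Ioi 0)).prod (volume.restrict (Ioi 0))) ∧
    ∫ τ : ℝ × ℝ, τ.1 ^ (ρ - 1) * exp (-τ.1) * exp (-τ.2 ^ 2) *
        exp (-((τ.1 * r) ^ 2 / (4 * τ.2 ^ 2)))
      ∂((volume.restrict (Ioi 0)).prod (volume.restrict (Ioi 0)))
      = √π / 2 * Gamma ρ * (r + 1) ^ (-ρ) := by
  have hG := Gamma_pos_of_pos hρ
  have inner : ∀ t ∈ Ioi (0 : ℝ),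
      ∫ v in Ioi (0 : ℝ), t ^ (ρ - 1) * exp (-t) * exp (-v ^ 2) *
        exp (-((t * r) ^ 2 / (4 * v ^ 2))) = √π / 2 * (t ^ (ρ - 1) * exp (-((r + 1) * t))) := by
    intro t ht
    simp_rw [mul_assoc (t ^ (ρ - 1) * exp (-t))]
    rw [integral_const_mul,
      (exp_neg_eq_integral_gaussian (mul_nonneg (le_of_lt ht) hr)).2,
      show -((r + 1) * t) = -t + -(t * r) by ring, exp_add]
    ring
  have outer := integral_rpow_mul_exp_neg_mul_Ioi hρ (by positivity : 0 < r + 1)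
  have hI : IntegrableOn (fun t : ℝ => t ^ (ρ - 1) * exp (-((r + 1) * t))) (Ioi 0) := by
    refine Integrable.of_integral_ne_zero ?_
    rw [outer]
    positivity
  have hint : Integrable (fun τ : ℝ × ℝ => τ.1 ^ (ρ - 1) * exp (-τ.1) * exp (-τ.2 ^ 2) *
        exp (-((τ.1 * r) ^ 2 / (4 * τ.2 ^ 2))))
      ((volume.restrict (Ioi 0)).prod (volume.restrict (Ioi 0))) := by
    rw [integrable_prod_iff (by apply Measurable.aestronglyMeasurable; fun_prop)]
    constructor
    · refine (ae_restrict_iff' measurableSet_Ioi).2 (ae_of_all _ fun t ht => ?_)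
      simp_rw [mul_assoc (t ^ (ρ - 1) * exp (-t))]
      exact (exp_neg_eq_integral_gaussian (mul_nonneg (le_of_lt ht) hr)).1.const_mul _
    · refine (hI.const_mul (√π / 2)).congr ?_
      refine (ae_restrict_iff' measurableSet_Ioi).2 (ae_of_all _ fun t ht => ?_)
      simp only
      rw [← inner t ht]
      refine integral_congr_ae (ae_of_all _ fun v => ?_)
      have ht0 : 0 < t := ht
      simp only
      rw [norm_of_nonneg (by positivity)]
  refine ⟨hint, ?_⟩
  rw [integral_prod _ hint, setIntegral_congr_fun measurableSet_Ioi inner, integral_const_mul,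
    outer, one_div, inv_rpow (by positivity), rpow_neg (by positivity)]
  ring

/-- The Fourier transform of a mixture of centered Gaussian densities has no zeros. -/
theorem integral_cexp_mul_ne_zero_of_gaussian_mixture {T : Type*} [MeasurableSpace T]
    {Λ : Measure T} [SFinite Λ] (hΛ : Λ ≠ 0) {w c : T → ℝ} (hw : Measurable w)
    (hc : Measurable c) (hwpos : ∀ᵐ τ ∂Λ, 0 < w τ) (hcpos : ∀ᵐ τ ∂Λ, 0 < c τ)
    {f : E d → ℝ} (hf : Integrable f)
    (hfi : ∀ x : E d, Integrable (fun τ => w τ * exp (-c τ * ‖x‖ ^ 2)) Λ)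
    (hfe : ∀ x : E d, f x = ∫ τ, w τ * exp (-c τ * ‖x‖ ^ 2) ∂Λ) (θ : E d) :
    ∫ x, Complex.exp (inner ℝ x θ * Complex.I) * f x ≠ 0 := by
  have hH : Integrable (fun p : E d × T => Complex.exp (inner ℝ p.1 θ * Complex.I) *
      ((w p.2 * exp (-c p.2 * ‖p.1‖ ^ 2) : ℝ) : ℂ)) (volume.prod Λ) := by
    have hn : ∀ (x : E d), ‖Complex.exp (inner ℝ x θ * Complex.I)‖ = 1 :=
      fun x => Complex.norm_exp_ofReal_mul_I _
    rw [integrable_prod_iff (by apply Measurable.aestronglyMeasurable; fun_prop)]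
    refine ⟨ae_of_all _ fun x => (hfi x).ofReal.const_mul
      (Complex.exp (inner ℝ x θ * Complex.I)), ?_⟩
    refine hf.congr (ae_of_all _ fun x => ?_)
    simp only
    rw [hfe x]
    refine integral_congr_ae ?_
    filter_upwards [hwpos] with τ hτ
    rw [norm_mul, hn, one_mul, Complex.norm_real, norm_of_nonneg (by positivity)]
  -- The Fourier transform of each Gaussian component at θ is real and positive, so the mixture,
  -- being the integral of `J` over a nonzero measure, is positive.
  set J : T → ℝ := fun τ => w τ * ((π / c τ) ^ ((d : ℝ) / 2) * exp (-‖θ‖ ^ 2 / (4 * c τ))) with hJ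
  have hin : ∀ᵐ τ ∂Λ, ∫ x : E d, Complex.exp (inner ℝ x θ * Complex.I) *
      ((w τ * exp (-c τ * ‖x‖ ^ 2) : ℝ) : ℂ) = (J τ : ℂ) := by
    filter_upwards [hcpos] with τ hτ
    have := GaussianFourier.integral_cexp_neg_mul_sq_norm_add (V := E d) (b := (c τ : ℂ))
      (by simpa using hτ) Complex.I θ
    have e : ∀ x : E d, Complex.exp (inner ℝ x θ * Complex.I) *
        ((w τ * exp (-c τ * ‖x‖ ^ 2) : ℝ) : ℂ) =
        w τ * Complex.exp (-(c τ : ℂ) * ‖x‖ ^ 2 + Complex.I * inner ℝ θ x) := by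
      intro x
      rw [Complex.exp_add, real_inner_comm]
      push_cast
      ring_nf
    simp_rw [e]
    rw [integral_const_mul, this, hJ]
    push_cast
    rw [Complex.ofReal_cpow (by positivity)]
    simp
  have key : ∫ x, Complex.exp (inner ℝ x θ * Complex.I) * f x = ((∫ τ, J τ ∂Λ : ℝ) : ℂ) := by
    rw [← integral_complex_ofReal, ← integral_congr_ae hin, ← integral_integral_swap hH]
    refine integral_congr_ae (ae_of_all _ fun x => ?_)
    simp only
    rw [integral_const_mul, integral_complex_ofReal, ← hfe x]
  rw [key, Complex.ofReal_ne_zero]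
  have hJpos : ∀ᵐ τ ∂Λ, 0 < J τ := by
    filter_upwards [hwpos, hcpos] with τ h1 h2
    have := pi_pos
    positivity
  have hJi : Integrable J Λ := by
    have := (hH.integral_prod_right.congr hin).re
    simpa using this
  refine (lt_of_le_of_ne (integral_nonneg_of_ae (hJpos.mono fun _ h => h.le)) fun h => ?_).ne'
  have h0 := (integral_eq_zero_iff_of_nonneg_ae (hJpos.mono fun _ h => h.le) hJi).1 h.symm
  have : ∀ᵐ τ ∂Λ, False := by
    filter_upwards [hJpos, h0] with τ h1 h2
    exact h1.ne' h2
  exact hΛ (by simpa using this)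

end GaussianMixture

/-! ### Injectivity of the smoothing and positivity under the alternative -/

section Injectivity

variable {ρ σ : ℝ}

theorem charFun_kernelLaw_ne_zero (hρ : (d : ℝ) < ρ) (hσ : 0 < σ) (θ : E d) :
    charFun (kernelLaw d ρ σ) θ ≠ 0 := by
  have hρ0 : 0 < ρ := lt_of_le_of_lt (by positivity) hρ
  have hG := Real.Gamma_pos_of_pos hρ0
  have hC := integral_norm_add_one_rpow_pos (d := d) hρ
  -- The normalizing constant of the kernel divided by the constant √π/2 · Γ(ρ) of the mixture
  -- formula at r = |x|/σ.
  set A : ℝ := (σ ^ d)⁻¹ * (∫ y : E d, (‖y‖ + 1) ^ (-ρ))⁻¹ / (√Real.pi / 2 * Real.Gamma ρ) with hA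
  have hpi := Real.pi_pos
  have hA0 : 0 < A := by positivity
  have hm : Measurable fun x : E d => ENNReal.ofReal (kernelDensity ρ σ x) :=
    (continuous_kernelDensity hσ).measurable.ennreal_ofReal
  rw [charFun_apply, kernelLaw, integral_withDensity_eq_integral_toReal_smul hm
    (ae_of_all _ fun _ => ENNReal.ofReal_lt_top)]
  have e : ∀ x : E d, (ENNReal.ofReal (kernelDensity ρ σ x)).toReal •
      Complex.exp (inner ℝ x θ * Complex.I) =
      Complex.exp (inner ℝ x θ * Complex.I) * kernelDensity ρ σ x := by
    intro x
    rw [ENNReal.toReal_ofReal (kernelDensity_nonneg hσ x), Complex.real_smul, mul_comm]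
  simp_rw [e]
  have hmem : ∀ᵐ τ : ℝ × ℝ ∂((volume.restrict (Set.Ioi 0)).prod (volume.restrict (Set.Ioi 0))),
      0 < τ.1 ∧ 0 < τ.2 := by
    rw [Measure.prod_restrict]
    exact (ae_restrict_iff' (measurableSet_Ioi.prod measurableSet_Ioi)).2
      (ae_of_all _ fun τ h => h)
  have hw : ∀ (x : E d) (τ : ℝ × ℝ), A * (τ.1 ^ (ρ - 1) * Real.exp (-τ.1) * Real.exp (-τ.2 ^ 2)) *
      Real.exp (-(τ.1 ^ 2 / (4 * τ.2 ^ 2 * σ ^ 2)) * ‖x‖ ^ 2)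
      = A * (τ.1 ^ (ρ - 1) * Real.exp (-τ.1) * Real.exp (-τ.2 ^ 2) *
        Real.exp (-((τ.1 * (‖x‖ / σ)) ^ 2 / (4 * τ.2 ^ 2)))) := by
    intro x τ
    rw [mul_assoc A]
    congr 3
    rw [neg_mul]
    congr 1
    rw [mul_pow, div_pow, div_mul_eq_mul_div, mul_div_assoc', div_div]
    congr 1
    ring
  refine integral_cexp_mul_ne_zero_of_gaussian_mixture
    (Λ := (volume.restrict (Set.Ioi 0)).prod (volume.restrict (Set.Ioi 0)))
    (w := fun τ : ℝ × ℝ => A * (τ.1 ^ (ρ - 1) * Real.exp (-τ.1) * Real.exp (-τ.2 ^ 2)))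
    (c := fun τ => τ.1 ^ 2 / (4 * τ.2 ^ 2 * σ ^ 2))
    ?_ (by fun_prop) (by fun_prop) ?_ ?_ (integrable_kernelDensity hρ hσ) ?_ ?_ θ
  · intro h
    have := congrArg (fun m => m Set.univ) h
    simp [← Set.univ_prod_univ, Measure.prod_prod] at this
  · filter_upwards [hmem] with τ ⟨h1, h2⟩
    positivity
  · filter_upwards [hmem] with τ ⟨h1, h2⟩
    positivity
  · intro x
    simp_rw [hw]
    exact (rpow_neg_add_one_eq_integral_gaussian hρ0 (by positivity)).1.const_mul _
  · intro x
    simp_rw [hw]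
    rw [integral_const_mul,
      (rpow_neg_add_one_eq_integral_gaussian hρ0 (by positivity : 0 ≤ ‖x‖ / σ)).2, hA,
      kernelDensity]
    field_simp

/-- The integrals are the Lebesgue densities of the convolutions of ν₁ and ν₂ with the kernel law.
Characteristic functions turn convolution into a product, and the nonvanishing factor of the kernel
cancels. -/
theorem eq_of_lintegral_kernelDensity_eq (hρ : (d : ℝ) < ρ) (hσ : 0 < σ)
    {ν₁ ν₂ : Measure (E d)} [IsFiniteMeasure ν₁] [IsFiniteMeasure ν₂]
    (h : ∀ᵐ x : E d, ∫⁻ u, ENNReal.ofReal (kernelDensity ρ σ (x - u)) ∂ν₁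
      = ∫⁻ u, ENNReal.ofReal (kernelDensity ρ σ (x - u)) ∂ν₂) : ν₁ = ν₂ := by
  have := isProbabilityMeasure_kernelLaw (d := d) hρ hσ
  have hf := (continuous_kernelDensity (d := d) (ρ := ρ) hσ).measurable
  have hf2 : Measurable fun p : E d × E d => ENNReal.ofReal (kernelDensity ρ σ (p.2 - p.1)) :=
    (hf.comp (by fun_prop : Measurable fun p : E d × E d => p.2 - p.1)).ennreal_ofReal
  have conv_eq : ∀ (ν : Measure (E d)) [IsFiniteMeasure ν] (g : E d → ℝ≥0∞), Measurable g →
      ∫⁻ x, g x ∂(ν ∗ kernelLaw d ρ σ)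
        = ∫⁻ x, (∫⁻ u, ENNReal.ofReal (kernelDensity ρ σ (x - u)) ∂ν) * g x := by
    intro ν _ g hg
    rw [Measure.conv, lintegral_map hg (by fun_prop), lintegral_prod _ (by fun_prop)]
    have e : ∀ u : E d, ∫⁻ ξ, g (u + ξ) ∂(kernelLaw d ρ σ)
        = ∫⁻ x, ENNReal.ofReal (kernelDensity ρ σ (x - u)) * g x := by
      intro u
      rw [kernelLaw, lintegral_withDensity_eq_lintegral_mul _ (by fun_prop) (by fun_prop),
        ← lintegral_sub_right_eq_self _ u]
      simp
    simp_rw [e]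
    rw [lintegral_lintegral_swap (by fun_prop)]
    refine lintegral_congr fun x => ?_
    exact lintegral_mul_const _
      (f := fun u => ENNReal.ofReal (kernelDensity ρ σ (x - u)))
      (hf.comp (measurable_const.sub measurable_id)).ennreal_ofReal
  have hconv : ν₁ ∗ kernelLaw d ρ σ = ν₂ ∗ kernelLaw d ρ σ := by
    refine Measure.ext_of_lintegral _ fun g hg => ?_
    rw [conv_eq ν₁ g hg, conv_eq ν₂ g hg]
    refine lintegral_congr_ae ?_
    filter_upwards [h] with x hx
    rw [hx]
  refine Measure.ext_of_charFun (funext fun θ => ?_)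
  have h1 := congrArg (fun m => charFun m θ) hconv
  simp only [charFun_conv] at h1
  exact mul_right_cancel₀ (charFun_kernelLaw_ne_zero hρ hσ θ) h1

/-- Coordinate by coordinate, the positive and negative parts of Y - X define two finite measures. A
vanishing smoothed drift says that their images under X have the same smoothing, hence agree by
injectivity. -/
theorem setIntegral_eq_zero_of_smoothedDrift_ae_eq_zero (hρ : (d : ℝ) < ρ) (hσ : 0 < σ)
    {P : Measure (E d × E d)} [IsProbabilityMeasure P]
    (hX : Integrable Prod.fst P) (hY : Integrable Prod.snd P)
    (h : smoothedDrift ρ σ P =ᵐ[volume] 0) {A : Set (E d)} (hA : MeasurableSet A) :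
    ∫ z in Prod.fst ⁻¹' A, (z.2 - z.1) ∂P = 0 := by
  have hf := (continuous_kernelDensity (d := d) (ρ := ρ) hσ).measurable
  have hint : Integrable (fun z : E d × E d => z.2 - z.1) P := hY.sub hX
  ext j
  have hj : Integrable (fun z : E d × E d => (z.2 - z.1) j) P :=
    (EuclideanSpace.proj (𝕜 := ℝ) j).integrable_comp hint
  have comm : (∫ z in Prod.fst ⁻¹' A, (z.2 - z.1) ∂P) j
      = ∫ z in Prod.fst ⁻¹' A, (z.2 - z.1) j ∂P :=
    ((EuclideanSpace.proj (𝕜 := ℝ) j).integral_comp_comm hint.integrableOn).symm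
  rw [comm]
  have fin1 : IsFiniteMeasure (P.withDensity fun z => ENNReal.ofReal ((z.2 - z.1) j)) :=
    isFiniteMeasure_withDensity_ofReal hj.2
  have fin2 : IsFiniteMeasure (P.withDensity fun z => ENNReal.ofReal (-(z.2 - z.1) j)) :=
    isFiniteMeasure_withDensity_ofReal hj.neg.2
  have hν : (P.withDensity fun z => ENNReal.ofReal ((z.2 - z.1) j)).map Prod.fst
      = (P.withDensity fun z => ENNReal.ofReal (-(z.2 - z.1) j)).map Prod.fst := by
    refine eq_of_lintegral_kernelDensity_eq hρ hσ ?_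
    filter_upwards [h] with x hx
    have hfx : Measurable fun u : E d => kernelDensity ρ σ (x - u) := hf.comp (by fun_prop)
    have hbd : ∀ u : E d, ‖kernelDensity ρ σ (x - u)‖
        ≤ (σ ^ d)⁻¹ * (∫ y : E d, (‖y‖ + 1) ^ (-ρ))⁻¹ := fun u => by
      rw [Real.norm_of_nonneg (kernelDensity_nonneg hσ _)]
      exact kernelDensity_le hρ hσ _
    have hi : Integrable (fun z : E d × E d => kernelDensity ρ σ (x - z.1) • (z.2 - z.1)) P :=
      hint.bdd_smul _ (hfx.comp measurable_fst).aestronglyMeasurable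
        (ae_of_all _ fun z => hbd z.1)
    have hij : Integrable
        (fun z : E d × E d => kernelDensity ρ σ (x - z.1) * (z.2 - z.1) j) P :=
      (EuclideanSpace.proj (𝕜 := ℝ) j).integrable_comp hi
    have h0 : ∫ z, kernelDensity ρ σ (x - z.1) * (z.2 - z.1) j ∂P = 0 := by
      have := (EuclideanSpace.proj (𝕜 := ℝ) j).integral_comp_comm hi
      refine this.trans ?_
      rw [← smoothedDrift, hx]
      simp
    have hpos : ∀ {s : ℝ} {u : E d}, ENNReal.ofReal s * ENNReal.ofReal (kernelDensity ρ σ (x - u))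
        = ENNReal.ofReal (kernelDensity ρ σ (x - u) * s) := fun {s u} => by
      rw [mul_comm, ENNReal.ofReal_mul (kernelDensity_nonneg hσ _)]
    rw [lintegral_map hfx.ennreal_ofReal measurable_fst,
      lintegral_map hfx.ennreal_ofReal measurable_fst,
      lintegral_withDensity_eq_lintegral_mul _ (by fun_prop) (by fun_prop),
      lintegral_withDensity_eq_lintegral_mul _ (by fun_prop) (by fun_prop)]
    simp only [Pi.mul_apply, hpos, mul_neg]
    rw [integral_eq_lintegral_pos_part_sub_lintegral_neg_part hij, sub_eq_zero] at h0
    exact (ENNReal.toReal_eq_toReal_iff' (hij.lintegral_lt_top).ne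
      (hij.neg.lintegral_lt_top).ne).1 h0
  have h1 := congrArg (fun m => m A) hν
  have hA' : MeasurableSet ((Prod.fst : E d × E d → E d) ⁻¹' A) := measurable_fst hA
  simp only at h1
  rw [Measure.map_apply measurable_fst hA, Measure.map_apply measurable_fst hA,
    withDensity_apply _ hA', withDensity_apply _ hA'] at h1
  rw [integral_eq_lintegral_pos_part_sub_lintegral_neg_part hj.integrableOn, h1, sub_self]
  rfl

/-- If the martingale property fails, then the smoothed martingale projection distance is
positive. -/
theorem lintegral_enorm_smoothedDrift_pos (hρ : (d : ℝ) < ρ) (hσ : 0 < σ)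
    {P : Measure (E d × E d)} [IsProbabilityMeasure P]
    (hX : Integrable Prod.fst P) (hY : Integrable Prod.snd P)
    (h : 0 < P {z | (P[(Prod.snd : E d × E d → E d) |
      MeasurableSpace.comap (Prod.fst : E d × E d → E d) inferInstance]) z ≠ z.1}) :
    0 < ∫⁻ x, ‖smoothedDrift ρ σ P x‖ₑ := by
  refine pos_iff_ne_zero.2 fun h0 => h.ne' ?_
  rw [lintegral_eq_zero_iff (stronglyMeasurable_smoothedDrift hσ P).measurable.enorm] at h0
  have hz : smoothedDrift ρ σ P =ᵐ[volume] 0 := by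
    filter_upwards [h0] with x hx
    simpa using hx
  have := condExp_comap_eq_of_setIntegral (U := Prod.fst) (b := id) hY measurable_fst
    measurable_id hX fun A hA => by
      have h1 := setIntegral_eq_zero_of_smoothedDrift_ae_eq_zero hρ hσ hX hY hz hA
      rw [integral_sub hY.integrableOn hX.integrableOn, sub_eq_zero] at h1
      exact h1.symm
  exact this

end Injectivity

/-! ### Almost sure convergence of the empirical smoothed distance -/

section LawOfLargeNumbers

/-- Generalized dominated convergence: the dominating functions may vary, provided that their
integrals converge. -/
theorem tendsto_lintegral_of_le_of_tendsto {T : Type*} [MeasurableSpace T] {ν : Measure T}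
    {a D : ℕ → T → ℝ≥0∞} {a' D' : T → ℝ≥0∞} (ha : ∀ n, Measurable (a n))
    (hD : ∀ n, Measurable (D n)) (hD' : Measurable D') (hle : ∀ n x, a n x ≤ D n x)
    (hat : ∀ᵐ x ∂ν, Tendsto (fun n => a n x) atTop (𝓝 (a' x)))
    (hDt : ∀ᵐ x ∂ν, Tendsto (fun n => D n x) atTop (𝓝 (D' x)))
    (hfin : ∫⁻ x, D' x ∂ν ≠ ⊤)
    (hint : Tendsto (fun n => ∫⁻ x, D n x ∂ν) atTop (𝓝 (∫⁻ x, D' x ∂ν))) :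
    Tendsto (fun n => ∫⁻ x, a n x ∂ν) atTop (𝓝 (∫⁻ x, a' x ∂ν)) := by
  -- Truncation at the limit majorant `D'` allows ordinary dominated convergence. The excess of `a
  -- n` over `D'` is at most that of `D n`, whose integral tends to zero by `hint`.
  have h1 : Tendsto (fun n => ∫⁻ x, min (a n x) (D' x) ∂ν) atTop (𝓝 (∫⁻ x, a' x ∂ν)) := by
    refine tendsto_lintegral_of_dominated_convergence D' (fun n => (ha n).min hD')
      (fun n => ae_of_all _ fun x => min_le_right _ _) hfin ?_
    filter_upwards [hat, hDt] with x h1 h2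
    have h3 : a' x ≤ D' x := le_of_tendsto_of_tendsto' h1 h2 fun n => hle n x
    simpa [min_eq_left h3] using h1.min (tendsto_const_nhds (x := D' x))
  have h2 : Tendsto (fun n => ∫⁻ x, min (D n x) (D' x) ∂ν) atTop (𝓝 (∫⁻ x, D' x ∂ν)) := by
    refine tendsto_lintegral_of_dominated_convergence D' (fun n => (hD n).min hD')
      (fun n => ae_of_all _ fun x => min_le_right _ _) hfin ?_
    filter_upwards [hDt] with x h2
    simpa using h2.min (tendsto_const_nhds (x := D' x))
  have h3 : Tendsto (fun n => ∫⁻ x, (D n x - min (D n x) (D' x)) ∂ν) atTop (𝓝 0) := by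
    have := ENNReal.Tendsto.sub hint h2 (Or.inl hfin)
    rw [tsub_self] at this
    refine this.congr fun n => (lintegral_sub ((hD n).min hD') ?_
      (ae_of_all _ fun x => min_le_left _ _)).symm
    exact ((lintegral_mono fun x => min_le_right _ _).trans_lt hfin.lt_top).ne
  have h4 := h1.add h3
  rw [add_zero] at h4
  refine tendsto_of_tendsto_of_tendsto_of_le_of_le h1 h4
    (fun n => lintegral_mono fun x => min_le_left _ _) (fun n => ?_)
  simp only
  rw [← lintegral_add_left ((ha n).min hD')]
  refine lintegral_mono fun x => ?_
  rcases le_total (a n x) (D' x) with h | h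
  · rw [min_eq_left h]; exact le_self_add
  · rw [min_eq_right h, min_eq_right (h.trans (hle n x)), add_tsub_cancel_of_le
      (h.trans (hle n x))]
    exact hle n x

variable {Ω : Type*} [MeasurableSpace Ω] {μ : Measure Ω}
  {P : Measure (E d × E d)} {Z : ℕ → Ω → E d × E d}
  {F : Type*} [NormedAddCommGroup F]

theorem ae_tendsto_average [NormedSpace ℝ F] [CompleteSpace F] [MeasurableSpace F]
    [BorelSpace F] (hlaw : ∀ i, HasLaw (Z i) P μ) (hindep : iIndepFun Z μ)
    {g : E d × E d → F} (hg : Measurable g) (hgi : Integrable g P) :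
    ∀ᵐ ω ∂μ, Tendsto (fun n : ℕ => (n : ℝ)⁻¹ • ∑ i ∈ Finset.range n, g (Z i ω)) atTop
      (𝓝 (∫ z, g z ∂P)) := by
  have hgi' := hgi
  rw [← (hlaw 0).map_eq] at hgi'
  have h := strong_law_ae (μ := μ) (fun i ω => g (Z i ω))
    ((integrable_map_measure hgi'.1 (hlaw 0).aemeasurable).1 hgi')
    (fun i j hij => (hindep.indepFun hij).comp hg hg)
    (fun i => ((hlaw i).identDistrib (hlaw 0)).comp hg)
  rw [← (hlaw 0).map_eq, integral_map (hlaw 0).aemeasurable hgi'.1]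
  exact h

/-- For each u the strong law has its own exceptional null set. Fubini on the jointly measurable
convergence set gives one null set of ω outside which convergence holds for almost every u. -/
theorem ae_ae_tendsto_average [NormedSpace ℝ F] [CompleteSpace F] [MeasurableSpace F]
    [BorelSpace F] [SecondCountableTopology F] [IsProbabilityMeasure μ]
    (hlaw : ∀ i, HasLaw (Z i) P μ) (hindep : iIndepFun Z μ) [SFinite P]
    {g : E d → E d × E d → F} (hg : Measurable fun p : E d × (E d × E d) => g p.1 p.2)
    (hgi : ∀ u, Integrable (g u) P) :
    ∀ᵐ ω ∂μ, ∀ᵐ u : E d,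
      Tendsto (fun n : ℕ => (n : ℝ)⁻¹ • ∑ i ∈ Finset.range n, g u (Z i ω)) atTop
        (𝓝 (∫ z, g u z ∂P)) := by
  -- `HasLaw` supplies only almost everywhere measurability; measurable versions are needed for the
  -- joint convergence set to be measurable.
  have hZ : ∀ᵐ ω ∂μ, ∀ i, Z i ω = (hlaw i).aemeasurable.mk (Z i) ω :=
    ae_all_iff.2 fun i => (hlaw i).aemeasurable.ae_eq_mk
  have hm : ∀ i, Measurable ((hlaw i).aemeasurable.mk (Z i)) :=
    fun i => (hlaw i).aemeasurable.measurable_mk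
  generalize hZ' : (fun i => (hlaw i).aemeasurable.mk (Z i)) = Z'
  have hZ2 : ∀ i, (hlaw i).aemeasurable.mk (Z i) = Z' i := fun i => congrFun hZ' i
  simp only [hZ2] at hZ hm
  have h1 : ∀ u : E d, ∀ᵐ ω ∂μ,
      Tendsto (fun n : ℕ => (n : ℝ)⁻¹ • ∑ i ∈ Finset.range n, g u (Z' i ω)) atTop
        (𝓝 (∫ z, g u z ∂P)) := by
    intro u
    filter_upwards [hZ, ae_tendsto_average hlaw hindep (hg.comp measurable_prodMk_left) (hgi u)]
      with ω h2 h3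
    simp only [h2] at h3
    exact h3
  have hmeas : MeasurableSet {p : E d × Ω |
      Tendsto (fun n : ℕ => (n : ℝ)⁻¹ • ∑ i ∈ Finset.range n, g p.1 (Z' i p.2)) atTop
        (𝓝 (∫ z, g p.1 z ∂P))} := by
    refine measurableSet_tendsto_fun (fun n => ?_) ?_
    · refine Measurable.const_smul (Finset.measurable_fun_sum _ fun i _ => ?_) _
      exact hg.comp (measurable_fst.prodMk ((hm i).comp measurable_snd))
    · exact (hg.stronglyMeasurable.integral_prod_right (ν := P)).measurable.comp measurable_fst
  have h2 := (Measure.ae_ae_comm (μ := (volume : Measure (E d))) (ν := μ) hmeas).1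
    (ae_of_all _ h1)
  filter_upwards [h2, hZ] with ω h3 h4
  simpa only [h4] using h3

theorem integral_empirical [NormedSpace ℝ F] [CompleteSpace F] (x y : ℕ → E d) (n : ℕ) (g : E d × E d → F) :
    ∫ z, g z ∂(empirical x y n) = (n : ℝ)⁻¹ • ∑ i ∈ Finset.range n, g (x i, y i) := by
  rw [empirical, integral_smul_measure, integral_finsetSum_measure]
  · simp [integral_dirac]
  · exact fun i _ => integrable_dirac (by simp)

theorem isProbabilityMeasure_empirical (x y : ℕ → E d) {n : ℕ} (hn : n ≠ 0) :
    IsProbabilityMeasure (empirical x y n) := by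
  refine ⟨?_⟩
  simp only [empirical, Measure.smul_apply, Measure.finsetSum_apply, measure_univ,
    Finset.sum_const, Finset.card_range, nsmul_eq_mul, mul_one, smul_eq_mul]
  exact ENNReal.inv_mul_cancel (by exact_mod_cast hn) (ENNReal.natCast_ne_top n)

theorem integrable_empirical (x y : ℕ → E d) {n : ℕ} (hn : n ≠ 0) (g : E d × E d → F) :
    Integrable g (empirical x y n) := by
  refine Integrable.smul_measure ?_ (ENNReal.inv_ne_top.2 (by exact_mod_cast hn))
  exact integrable_finsetSum_measure.2 fun i _ => integrable_dirac (by simp)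

variable {ρ σ : ℝ}

/-- Fubini and the unit mass of the kernel. The result is free of σ, which controls the majorants
here and gives uniformity in the bandwidth for the critical values. -/
theorem integral_integral_kernelDensity_mul (hρ : (d : ℝ) < ρ) (hσ : 0 < σ)
    [IsProbabilityMeasure P] {g : E d × E d → ℝ} (hg : Integrable g P) (hg0 : ∀ z, 0 ≤ g z) :
    ∫⁻ u : E d, ENNReal.ofReal (∫ z, kernelDensity ρ σ (u - z.1) * g z ∂P)
      = ENNReal.ofReal (∫ z, g z ∂P) := by
  have h := integrable_kernelDensity_smul_prod hρ hσ hg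
  have hr : Integrable (fun u : E d => ∫ z, kernelDensity ρ σ (u - z.1) * g z ∂P) :=
    h.integral_prod_right
  rw [← ofReal_integral_eq_lintegral_ofReal hr (ae_of_all _ fun u =>
    integral_nonneg fun z => mul_nonneg (kernelDensity_nonneg hσ _) (hg0 z))]
  congr 1
  refine (integral_integral_swap h).symm.trans (integral_congr_ae (ae_of_all _ fun z => ?_))
  simp only
  rw [integral_mul_const, integral_sub_right_eq_self (kernelDensity ρ σ) z.1,
    integral_kernelDensity hρ hσ, one_mul]

theorem integrable_kernelDensity_smul [NormedSpace ℝ F] (hρ : (d : ℝ) < ρ) (hσ : 0 < σ) {g : E d × E d → F}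
    (hg : Integrable g P) (u : E d) :
    Integrable (fun z => kernelDensity ρ σ (u - z.1) • g z) P := by
  refine hg.bdd_smul ((σ ^ d)⁻¹ * (∫ y : E d, (‖y‖ + 1) ^ (-ρ))⁻¹)
    ((continuous_kernelDensity hσ).comp (by fun_prop)).aestronglyMeasurable
    (ae_of_all _ fun z => ?_)
  rw [Real.norm_of_nonneg (kernelDensity_nonneg hσ _)]
  exact kernelDensity_le hρ hσ _

theorem ae_tendsto_smoothedMPD_empirical [IsProbabilityMeasure μ] [IsProbabilityMeasure P]
    {X Y : ℕ → Ω → E d} (hlaw : ∀ i, HasLaw (fun ω => (X i ω, Y i ω)) P μ)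
    (hindep : iIndepFun (fun i ω => (X i ω, Y i ω)) μ)
    (hρ : (d : ℝ) + 1 < ρ) (hσ : 0 < σ)
    (hX : Integrable Prod.fst P) (hY : Integrable Prod.snd P) :
    ∀ᵐ ω ∂μ, Tendsto (fun n => smoothedMPD ρ σ (empirical (X · ω) (Y · ω) n) 1) atTop
      (𝓝 (smoothedMPD ρ σ P 1)) := by
  have hρ' : (d : ℝ) < ρ := by linarith
  have hf := (continuous_kernelDensity (d := d) (ρ := ρ) hσ).measurable
  have hf2 : Measurable fun p : E d × (E d × E d) => kernelDensity ρ σ (p.1 - p.2.1) :=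
    hf.comp (by fun_prop)
  have hD : Integrable (fun z : E d × E d => z.2 - z.1) P := hY.sub hX
  have i1 : ∀ u : E d,
      Integrable (fun z : E d × E d => kernelDensity ρ σ (u - z.1) • (z.2 - z.1)) P :=
    fun u => integrable_kernelDensity_smul (g := fun z => z.2 - z.1) hρ' hσ hD u
  have i2 : ∀ u : E d,
      Integrable (fun z : E d × E d => kernelDensity ρ σ (u - z.1) • ‖z.2 - z.1‖) P :=
    fun u => integrable_kernelDensity_smul (g := fun z => ‖z.2 - z.1‖) hρ' hσ hD.norm u
  have m1 : Measurable fun p : E d × (E d × E d) => p.2.2 - p.2.1 := by fun_prop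
  have t1 := ae_ae_tendsto_average hlaw hindep
    (g := fun u z => kernelDensity ρ σ (u - z.1) • (z.2 - z.1)) (hf2.smul m1) i1
  have t2 := ae_ae_tendsto_average hlaw hindep
    (g := fun u z => kernelDensity ρ σ (u - z.1) • ‖z.2 - z.1‖) (hf2.smul m1.norm) i2
  have t3 := ae_tendsto_average hlaw hindep (g := fun z => ‖z.2 - z.1‖) (by fun_prop) hD.norm
  filter_upwards [t1, t2, t3] with ω h1 h2 h3
  rw [smoothedMPD_one_eq hρ hσ hX hY]
  -- The index is shifted by one because the empirical measure of zero observations is not a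
  -- probability measure.
  have key : Tendsto (fun n : ℕ =>
      ∫⁻ u, ‖smoothedDrift ρ σ (empirical (X · ω) (Y · ω) (n + 1)) u‖ₑ) atTop
      (𝓝 (∫⁻ u, ‖smoothedDrift ρ σ P u‖ₑ)) := by
    have hprob : ∀ n : ℕ, IsProbabilityMeasure (empirical (X · ω) (Y · ω) (n + 1)) :=
      fun n => isProbabilityMeasure_empirical _ _ n.succ_ne_zero
    refine tendsto_lintegral_of_le_of_tendsto
      (D := fun n u => ENNReal.ofReal (∫ z, kernelDensity ρ σ (u - z.1) * ‖z.2 - z.1‖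
        ∂(empirical (X · ω) (Y · ω) (n + 1))))
      (D' := fun u => ENNReal.ofReal (∫ z, kernelDensity ρ σ (u - z.1) * ‖z.2 - z.1‖ ∂P))
      (fun n => (stronglyMeasurable_smoothedDrift hσ _).measurable.enorm)
      (fun n => ?_) ?_ (fun n u => ?_) ?_ ?_ ?_ ?_
    · refine Measurable.ennreal_ofReal (StronglyMeasurable.measurable ?_)
      exact Measurable.stronglyMeasurable (f := fun p : E d × (E d × E d) =>
        kernelDensity ρ σ (p.1 - p.2.1) * ‖p.2.2 - p.2.1‖) (hf2.mul m1.norm) |>.integral_prod_right'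
    · refine Measurable.ennreal_ofReal (StronglyMeasurable.measurable ?_)
      exact Measurable.stronglyMeasurable (f := fun p : E d × (E d × E d) =>
        kernelDensity ρ σ (p.1 - p.2.1) * ‖p.2.2 - p.2.1‖) (hf2.mul m1.norm) |>.integral_prod_right'
    · rw [← ofReal_norm]
      refine ENNReal.ofReal_le_ofReal ((norm_integral_le_integral_norm _).trans (le_of_eq ?_))
      refine integral_congr_ae (ae_of_all _ fun z => ?_)
      simp only
      rw [norm_smul, Real.norm_of_nonneg (kernelDensity_nonneg hσ _)]
    · filter_upwards [h1] with u hu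
      have := (hu.comp (tendsto_add_atTop_nat 1)).enorm
      refine this.congr fun n => ?_
      rw [smoothedDrift, integral_empirical]
      rfl
    · filter_upwards [h2] with u hu
      have := ENNReal.tendsto_ofReal (hu.comp (tendsto_add_atTop_nat 1))
      refine this.congr fun n => ?_
      rw [integral_empirical]
      rfl
    · rw [integral_integral_kernelDensity_mul hρ' hσ hD.norm fun _ => norm_nonneg _]
      exact ENNReal.ofReal_ne_top
    · rw [integral_integral_kernelDensity_mul hρ' hσ hD.norm fun _ => norm_nonneg _]
      refine (ENNReal.tendsto_ofReal (h3.comp (tendsto_add_atTop_nat 1))).congr fun n => ?_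
      rw [integral_integral_kernelDensity_mul hρ' hσ
        (integrable_empirical _ _ n.succ_ne_zero _) fun _ => norm_nonneg _, integral_empirical]
      rfl
  rw [← tendsto_add_atTop_iff_nat 1]
  refine key.congr fun n => ?_
  have := isProbabilityMeasure_empirical (X · ω) (Y · ω) n.succ_ne_zero
  exact (smoothedMPD_one_eq hρ hσ (integrable_empirical _ _ n.succ_ne_zero _)
    (integrable_empirical _ _ n.succ_ne_zero _)).symm

end LawOfLargeNumbers

/-! ### A bound on the critical values uniform over σ ≥ 1 -/

section CriticalValue

variable {ρ σ s : ℝ}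

/-- `A_ρ⁻² A_s A_{2ρ-s}`, where `A_ρ = ∫ (|y| + 1)^{-ρ} dy`. -/
def kernelRatio (d : ℕ) (ρ s : ℝ) : ℝ :=
  ((∫ y : E d, (‖y‖ + 1) ^ (-ρ)) ^ 2)⁻¹ * (∫ y : E d, (‖y‖ + 1) ^ (-s)) *
    ∫ y : E d, (‖y‖ + 1) ^ (-(2 * ρ - s))

theorem kernelRatio_nonneg : 0 ≤ kernelRatio d ρ s := by
  have h : ∀ r : ℝ, 0 ≤ ∫ y : E d, (‖y‖ + 1) ^ (-r) :=
    fun r => integral_nonneg fun y => by positivity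
  exact mul_nonneg (mul_nonneg (by positivity) (h s)) (h _)

/-- For σ ≥ 1, 1 + |x|/σ ≤ (1 + |x - u|/σ)(1 + |u|). Hence s of the 2ρ powers of decay around u can
be moved to decay around 0, at the price (1 + |u|)^s; the powers of σ then match exactly and the
constant does not depend on σ. -/
theorem kernelDensity_sub_sq_le (hσ : 1 ≤ σ) (hs : (d : ℝ) < s) (hsρ : (d : ℝ) < 2 * ρ - s)
    (x u : E d) :
    kernelDensity ρ σ (x - u) ^ 2 ≤ kernelRatio d ρ s *
      (kernelDensity s σ x * (kernelDensity (2 * ρ - s) σ (x - u) * (1 + ‖u‖) ^ s)) := by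
  have hσ0 : 0 < σ := by linarith
  have hs0 : 0 ≤ s := le_trans (by positivity) hs.le
  have h1 := integral_norm_add_one_rpow_pos (d := d) (ρ := s) hs
  have h2 := integral_norm_add_one_rpow_pos (d := d) (ρ := 2 * ρ - s) hsρ
  have h3 : 0 ≤ ∫ y : E d, (‖y‖ + 1) ^ (-ρ) := integral_nonneg fun y => by positivity
  unfold kernelRatio kernelDensity
  set a := ‖x - u‖ / σ with ha
  set b := ‖x‖ / σ with hb
  have ha0 : 0 ≤ a := by positivity
  have hb0 : 0 ≤ b := by positivity
  have hba : b + 1 ≤ (a + 1) * (1 + ‖u‖) := by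
    have e1 : b ≤ a + ‖u‖ := by
      have : ‖x‖ ≤ ‖x - u‖ + ‖u‖ := by simpa using norm_add_le (x - u) u
      calc b ≤ (‖x - u‖ + ‖u‖) / σ := by rw [hb]; gcongr
        _ = a + ‖u‖ / σ := by rw [add_div]
        _ ≤ a + ‖u‖ := by gcongr; exact div_le_self (norm_nonneg _) hσ
    nlinarith [norm_nonneg u]
  have hp : (b + 1) ^ s ≤ (a + 1) ^ s * (1 + ‖u‖) ^ s := by
    rw [← Real.mul_rpow (by positivity) (by positivity)]
    exact Real.rpow_le_rpow (by positivity) hba hs0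
  have key : ((a + 1) ^ (-ρ)) ^ 2 ≤
      (b + 1) ^ (-s) * ((a + 1) ^ (-(2 * ρ - s)) * (1 + ‖u‖) ^ s) := by
    have e : ((a + 1) ^ (-ρ)) ^ 2 = (a + 1) ^ (-(2 * ρ - s)) * ((a + 1) ^ s)⁻¹ := by
      rw [← Real.rpow_natCast, ← Real.rpow_mul (by positivity), ← Real.rpow_neg (by positivity),
        ← Real.rpow_add (by positivity)]
      congr 1
      push_cast
      ring
    have hA : 0 < (a + 1) ^ s := by positivity
    have hB : 0 < (b + 1) ^ s := by positivity
    have hR : 0 < (a + 1) ^ (-(2 * ρ - s)) := by positivity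
    rw [e, Real.rpow_neg (by positivity : 0 ≤ b + 1)]
    have : ((a + 1) ^ s)⁻¹ ≤ ((b + 1) ^ s)⁻¹ * (1 + ‖u‖) ^ s := by
      rw [inv_mul_eq_div, le_div_iff₀ hB, inv_mul_le_iff₀ hA]
      exact hp
    calc _ ≤ (a + 1) ^ (-(2 * ρ - s)) * (((b + 1) ^ s)⁻¹ * (1 + ‖u‖) ^ s) := by gcongr
      _ = _ := by ring
  generalize (∫ y : E d, (‖y‖ + 1) ^ (-s)) = A1 at h1 ⊢
  generalize (∫ y : E d, (‖y‖ + 1) ^ (-(2 * ρ - s))) = A2 at h2 ⊢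
  generalize (∫ y : E d, (‖y‖ + 1) ^ (-ρ)) = A3 at h3 ⊢
  calc ((σ ^ d)⁻¹ * A3⁻¹ * (a + 1) ^ (-ρ)) ^ 2
      = ((σ ^ d)⁻¹ * A3⁻¹) ^ 2 * ((a + 1) ^ (-ρ)) ^ 2 := by ring
    _ ≤ ((σ ^ d)⁻¹ * A3⁻¹) ^ 2 *
        ((b + 1) ^ (-s) * ((a + 1) ^ (-(2 * ρ - s)) * (1 + ‖u‖) ^ s)) := by gcongr
    _ = _ := by field_simp

variable {P : Measure (E d × E d)}

/-- The trace of the covariance on the diagonal x = y; Gaussianity supplies the second moments. -/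
theorem IsLimitField.integral_norm_sq {Ω : Type} [MeasurableSpace Ω] {ν : Measure Ω}
    {G : E d → Ω → E d} (hG : IsLimitField ρ σ P ν G)
    (hD : Integrable (fun z : E d × E d => ‖z.2 - z.1‖ ^ 2) P) (hρ : (d : ℝ) < ρ) (hσ : 0 < σ)
    (x : E d) : Integrable (fun ω => ‖G x ω‖ ^ 2) ν ∧
    ∫ ω, ‖G x ω‖ ^ 2 ∂ν = ∫ z, ‖z.2 - z.1‖ ^ 2 * kernelDensity ρ σ (x - z.1) ^ 2 ∂P := by
  have hL : MemLp (G x) 2 ν := (hG.gaussian.hasGaussianLaw_eval x).memLp_two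
  have hLj : ∀ j, Integrable (fun ω => G x ω j * G x ω j) ν := fun j => by
    have : MemLp (fun ω => G x ω j) 2 ν :=
      (EuclideanSpace.proj (𝕜 := ℝ) j).comp_memLp' hL
    exact this.integrable_mul this
  have hf := (continuous_kernelDensity (d := d) (ρ := ρ) hσ).measurable
  have hfx : Measurable fun z : E d × E d => kernelDensity ρ σ (x - z.1) := hf.comp (by fun_prop)
  have hDj : ∀ j, Integrable (fun z : E d × E d => (z.2 - z.1) j * kernelDensity ρ σ (x - z.1) *
      kernelDensity ρ σ (x - z.1) * (z.2 - z.1) j) P := fun j => by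
    refine (hD.const_mul (((σ ^ d)⁻¹ * (∫ y : E d, (‖y‖ + 1) ^ (-ρ))⁻¹) ^ 2)).mono
      (by apply Measurable.aestronglyMeasurable; fun_prop) (ae_of_all _ fun z => ?_)
    have h1 := kernelDensity_nonneg (ρ := ρ) hσ (x - z.1)
    have h2 := kernelDensity_le hρ hσ (x - z.1)
    have h3 : ‖(z.2 - z.1) j‖ ≤ ‖z.2 - z.1‖ := PiLp.norm_apply_le _ _
    rw [norm_mul, norm_mul, norm_mul, Real.norm_of_nonneg h1, norm_mul, norm_pow, norm_pow,
      norm_norm]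
    calc _ = kernelDensity ρ σ (x - z.1) ^ 2 * ‖(z.2 - z.1) j‖ ^ 2 := by ring
      _ ≤ _ := by
        gcongr
        exact h2.trans (le_abs_self _)
  refine ⟨hL.integrable_norm_pow (by norm_num), ?_⟩
  have e1 : ∀ ω, ‖G x ω‖ ^ 2 = ∑ j, G x ω j * G x ω j := fun ω => by
    rw [EuclideanSpace.real_norm_sq_eq]
    exact Finset.sum_congr rfl fun j _ => sq _
  have e2 : ∀ z : E d × E d, ‖z.2 - z.1‖ ^ 2 * kernelDensity ρ σ (x - z.1) ^ 2 =
      ∑ j, (z.2 - z.1) j * kernelDensity ρ σ (x - z.1) *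
        kernelDensity ρ σ (x - z.1) * (z.2 - z.1) j := fun z => by
    rw [EuclideanSpace.real_norm_sq_eq, Finset.sum_mul]
    exact Finset.sum_congr rfl fun j _ => by ring
  simp_rw [e1, e2]
  rw [integral_finsetSum _ fun j _ => hLj j, integral_finsetSum _ fun j _ => hDj j]
  exact Finset.sum_congr rfl fun j _ => hG.covariance x x j j

/-- A bound for `E ∫ |G_x| dx` that does not depend on the bandwidth `σ ≥ 1`. -/
theorem IsLimitField.lintegral_lintegral_enorm_le [IsProbabilityMeasure P] {Ω : Type}
    [MeasurableSpace Ω] {ν : Measure Ω} {G : E d → Ω → E d} (hG : IsLimitField ρ σ P ν G)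
    (hρ : (d : ℝ) < ρ) (hσ : 1 ≤ σ) (hs : (d : ℝ) < s) (hsρ : (d : ℝ) < 2 * ρ - s)
    (hD : Integrable (fun z : E d × E d => ‖z.2 - z.1‖ ^ 2 * (1 + ‖z.1‖) ^ s) P) :
    ∫⁻ ω, (∫⁻ x, ‖G x ω‖ₑ) ∂ν ≤ ENNReal.ofReal
      (1 + kernelRatio d ρ s * ∫ z, ‖z.2 - z.1‖ ^ 2 * (1 + ‖z.1‖) ^ s ∂P) := by
  have hσ0 : 0 < σ := by linarith
  have hs0 : 0 ≤ s := le_trans (by positivity) hs.le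
  have hν : IsProbabilityMeasure ν := hG.gaussian.isProbabilityMeasure
  set D : E d × E d → ℝ := fun z => ‖z.2 - z.1‖ ^ 2 * (1 + ‖z.1‖) ^ s with hDdef
  have hD0 : ∀ z, 0 ≤ D z := fun z => by positivity
  have hD2 : Integrable (fun z : E d × E d => ‖z.2 - z.1‖ ^ 2) P := by
    refine hD.mono (by apply Measurable.aestronglyMeasurable; fun_prop)
      (ae_of_all _ fun z => ?_)
    rw [Real.norm_of_nonneg (by positivity), Real.norm_of_nonneg (hD0 z)]
    exact le_mul_of_one_le_right (by positivity) (Real.one_le_rpow (by simp) hs0)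
  have hC := kernelRatio_nonneg (d := d) (ρ := ρ) (s := s)
  have hpt : ∀ x : E d, ∫⁻ ω, ‖G x ω‖ₑ ∂ν ≤ ENNReal.ofReal (kernelDensity s σ x) +
      ENNReal.ofReal (kernelRatio d ρ s) *
        ENNReal.ofReal (∫ z, kernelDensity (2 * ρ - s) σ (x - z.1) * D z ∂P) := by
    intro x
    obtain ⟨hi, he⟩ := hG.integral_norm_sq hD2 hρ hσ0 x
    have hq := kernelDensity_pos hs hσ0 x
    have hL : Integrable (G x) ν := (hG.gaussian.hasGaussianLaw_eval x).integrable
    have hk : ∀ z : E d × E d, 0 ≤ kernelDensity (2 * ρ - s) σ (x - z.1) * D z :=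
      fun z => mul_nonneg (kernelDensity_nonneg hσ0 _) (hD0 z)
    have hV : ∫ ω, ‖G x ω‖ ^ 2 ∂ν ≤ kernelRatio d ρ s * (kernelDensity s σ x *
        ∫ z, kernelDensity (2 * ρ - s) σ (x - z.1) * D z ∂P) := by
      rw [he, ← integral_const_mul, ← integral_const_mul]
      refine integral_mono_of_nonneg (ae_of_all _ fun z => by positivity)
        (((integrable_kernelDensity_smul hsρ hσ0 hD x).const_mul _).const_mul _)
        (ae_of_all _ fun z => ?_)
      have := mul_le_mul_of_nonneg_left (kernelDensity_sub_sq_le (ρ := ρ) hσ hs hsρ x z.1)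
        (sq_nonneg ‖z.2 - z.1‖)
      refine this.trans (le_of_eq ?_)
      simp only [hDdef]
      ring
    -- Uses g ≤ q + g²/q with q the kernel of exponent s at x. Since q has integral one it
    -- contributes the summand 1 of the final bound, and dividing the variance bound by q leaves a
    -- kernel of exponent 2ρ - s, again of mass one.
    have hE : ∫ ω, ‖G x ω‖ ∂ν ≤ kernelDensity s σ x + kernelRatio d ρ s *
        ∫ z, kernelDensity (2 * ρ - s) σ (x - z.1) * D z ∂P := by
      have h1 : ∫ ω, ‖G x ω‖ ∂ν ≤ ∫ ω, (kernelDensity s σ x +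
          (kernelDensity s σ x)⁻¹ * ‖G x ω‖ ^ 2) ∂ν := by
        refine integral_mono hL.norm ((integrable_const _).add (hi.const_mul _)) fun ω => ?_
        simp only
        rw [← sub_nonneg]
        have : kernelDensity s σ x + (kernelDensity s σ x)⁻¹ * ‖G x ω‖ ^ 2 - ‖G x ω‖
            = (kernelDensity s σ x)⁻¹ * ((kernelDensity s σ x - ‖G x ω‖ / 2) ^ 2
              + 3 / 4 * ‖G x ω‖ ^ 2) := by
          field_simp
          ring
        rw [this]
        positivity
      rw [integral_add (integrable_const _) (hi.const_mul _), integral_const_mul] at h1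
      simp only [integral_const, probReal_univ, one_smul] at h1
      refine h1.trans (add_le_add_right ?_ _)
      rw [inv_mul_le_iff₀ hq]
      refine hV.trans (le_of_eq ?_)
      ring
    rw [← ofReal_integral_norm_eq_lintegral_enorm hL, ← ENNReal.ofReal_mul hC,
      ← ENNReal.ofReal_add hq.le (mul_nonneg hC (integral_nonneg hk))]
    exact ENNReal.ofReal_le_ofReal hE
  have hm : Measurable fun p : Ω × E d => ‖G p.2 p.1‖ₑ :=
    (hG.measurable.comp measurable_swap).enorm
  rw [lintegral_lintegral_swap hm.aemeasurable]
  refine (lintegral_mono hpt).trans ?_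
  have hmq : Measurable fun x : E d => ENNReal.ofReal (kernelDensity s σ x) :=
    (continuous_kernelDensity hσ0).measurable.ennreal_ofReal
  rw [lintegral_add_left hmq, lintegral_const_mul' _ _ ENNReal.ofReal_ne_top,
    integral_integral_kernelDensity_mul hsρ hσ0 hD hD0,
    ← ofReal_integral_eq_lintegral_ofReal (integrable_kernelDensity hs hσ0)
      (ae_of_all _ (kernelDensity_nonneg hσ0)), integral_kernelDensity hs hσ0,
    ← ENNReal.ofReal_mul hC, ← ENNReal.ofReal_add zero_le_one
      (mul_nonneg hC (integral_nonneg hD0))]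

theorem criticalValue_le [IsProbabilityMeasure P] {α : ℝ} (hα : 0 < α)
    (hρ : (d : ℝ) < ρ) (hσ : 1 ≤ σ) (hs : (d : ℝ) < s) (hsρ : (d : ℝ) < 2 * ρ - s)
    (hD : Integrable (fun z : E d × E d => ‖z.2 - z.1‖ ^ 2 * (1 + ‖z.1‖) ^ s) P) :
    criticalValue α ρ σ P ≤
      (1 + kernelRatio d ρ s * ∫ z, ‖z.2 - z.1‖ ^ 2 * (1 + ‖z.1‖) ^ s ∂P) / α := by
  set M : ℝ := 1 + kernelRatio d ρ s * ∫ z, ‖z.2 - z.1‖ ^ 2 * (1 + ‖z.1‖) ^ s ∂P with hM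
  have hM0 : 0 < M := by
    have h1 := kernelRatio_nonneg (d := d) (ρ := ρ) (s := s)
    have h2 : 0 ≤ ∫ z, ‖z.2 - z.1‖ ^ 2 * (1 + ‖z.1‖) ^ s ∂P :=
      integral_nonneg fun z => by positivity
    positivity
  by_cases hne : ∃ L, IsLimitLaw ρ σ P L
  · obtain ⟨L, hL⟩ := hne
    refine csInf_le ⟨0, fun c hc => hc.1⟩ ⟨by positivity, L, hL, ?_⟩
    obtain ⟨Ω, mΩ, ν, G, hG, rfl⟩ := hL
    have hν : IsProbabilityMeasure ν := hG.gaussian.isProbabilityMeasure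
    have hbound := hG.lintegral_lintegral_enorm_le hρ hσ hs hsρ hD
    have hS : Measurable fun ω => ∫⁻ x, ‖G x ω‖ₑ :=
      Measurable.lintegral_prod_right (f := fun ω x => ‖G x ω‖ₑ)
        (hG.measurable.comp measurable_swap).enorm
    rw [Measure.map_apply hS measurableSet_Iic]
    have hc : 0 < M / α := by positivity
    have markov := (mul_meas_ge_le_lintegral hS (ENNReal.ofReal (M / α)) (μ := ν)).trans hbound
    have h1 : ν {ω | ENNReal.ofReal (M / α) ≤ ∫⁻ x, ‖G x ω‖ₑ} ≤ ENNReal.ofReal α := by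
      have h2 : ENNReal.ofReal M = ENNReal.ofReal (M / α) * ENNReal.ofReal α := by
        rw [← ENNReal.ofReal_mul hc.le]
        congr 1
        field_simp
      rw [← hM, h2] at markov
      exact (ENNReal.mul_le_mul_iff_right (by simpa using hc) ENNReal.ofReal_ne_top).1 markov
    have h3 : ((fun ω => ∫⁻ x, ‖G x ω‖ₑ) ⁻¹' Set.Iic (ENNReal.ofReal (M / α)))ᶜ ⊆
        {ω | ENNReal.ofReal (M / α) ≤ ∫⁻ x, ‖G x ω‖ₑ} := by
      intro ω hω
      simp only [Set.mem_compl_iff, Set.mem_preimage, Set.mem_Iic, not_le] at hω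
      exact hω.le
    rw [ENNReal.ofReal_sub _ hα.le, ENNReal.ofReal_one, tsub_le_iff_right,
      ← prob_add_prob_compl (μ := ν) (hS measurableSet_Iic)]
    gcongr
    exact (measure_mono h3).trans h1
  -- If no limit law is available, the critical value is the infimum of the empty set, which is 0 by
  -- convention, and the bound still holds.
  · have : {c : ℝ | 0 ≤ c ∧ ∃ L : Measure ℝ≥0∞, IsLimitLaw ρ σ P L ∧
        ENNReal.ofReal (1 - α) ≤ L (Set.Iic (ENNReal.ofReal c))} = ∅ := by
      refine Set.eq_empty_of_forall_notMem fun c hc => hne ?_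
      obtain ⟨_, L, hL, _⟩ := hc
      exact ⟨L, hL⟩
    rw [criticalValue, this, Real.sInf_empty]
    positivity

end CriticalValue

/-! ### From almost sure divergence to rejection probability one -/

section Consistency

/-- Continuity from below along the increasing events "in A n from N on". It holds for arbitrary
increasing sets, so the rejection events and the selected bandwidth need not be measurable. -/
theorem tendsto_measure_one_of_ae_eventually {Ω : Type*} [MeasurableSpace Ω] {μ : Measure Ω}
    [IsProbabilityMeasure μ] {A : ℕ → Set Ω} (h : ∀ᵐ ω ∂μ, ∀ᶠ n in atTop, ω ∈ A n) :
    Tendsto (fun n => μ (A n)) atTop (𝓝 1) := by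
  have hB : Monotone fun N : ℕ => {ω | ∀ n ≥ N, ω ∈ A n} :=
    fun N M hNM ω hω n hn => hω n (hNM.trans hn)
  have hU : μ (⋃ N, {ω | ∀ n ≥ N, ω ∈ A n}) = 1 := by
    rw [← measure_univ (μ := μ)]
    refine measure_congr (eventuallyEq_univ.2 ?_)
    filter_upwards [h] with ω hω
    obtain ⟨N, hN⟩ := eventually_atTop.1 hω
    exact Set.mem_iUnion.2 ⟨N, hN⟩
  have hlim := tendsto_measure_iUnion_atTop (μ := μ) hB
  rw [hU] at hlim
  exact tendsto_of_tendsto_of_tendsto_of_le_of_le hlim tendsto_const_nhds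
    (fun n => measure_mono fun ω hω => hω n le_rfl) fun n => prob_le_one

/-- Here `b` is the statistic in use and `a` a reference statistic with positive limit. For a fixed
bandwidth the two coincide and ε = 0; for a data-driven one, `a` is the statistic at bandwidth 1. -/
theorem tendsto_measure_lt_sqrt_mul {Ω : Type*} [MeasurableSpace Ω] {μ : Measure Ω}
    [IsProbabilityMeasure μ] {a b : ℕ → Ω → ℝ≥0∞} {l : ℝ≥0∞} {ε : ℕ → ℝ≥0∞} {c : ℕ → Ω → ℝ}
    {C : ℝ} (hl : 0 < l) (ha : ∀ᵐ ω ∂μ, Tendsto (fun n => a n ω) atTop (𝓝 l))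
    (hε : Tendsto ε atTop (𝓝 0)) (hab : ∀ n ω, a n ω ≤ b n ω + ε n) (hc : ∀ n ω, c n ω ≤ C) :
    Tendsto (fun n => μ {ω | ENNReal.ofReal (c n ω) < ENNReal.ofReal (Real.sqrt n) * b n ω})
      atTop (𝓝 1) := by
  refine tendsto_measure_one_of_ae_eventually ?_
  filter_upwards [ha] with ω hω
  obtain ⟨r, hr0, hrl⟩ := exists_between hl
  have h1 : Tendsto (fun n => a n ω - ε n) atTop (𝓝 l) := by
    simpa using ENNReal.Tendsto.sub hω hε (Or.inr ENNReal.zero_ne_top)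
  have h2 : Tendsto (fun n : ℕ => ENNReal.ofReal (Real.sqrt n) * r) atTop (𝓝 ⊤) := by
    have h3 : Tendsto (fun n : ℕ => ENNReal.ofReal (Real.sqrt n)) atTop (𝓝 ⊤) :=
      ENNReal.tendsto_ofReal_nhds_top.2
        (Real.tendsto_sqrt_atTop.comp tendsto_natCast_atTop_atTop)
    simpa [ENNReal.top_mul hr0.ne'] using
      ENNReal.Tendsto.mul_const (b := r) h3 (Or.inl ENNReal.top_ne_zero)
  filter_upwards [h1.eventually (lt_mem_nhds hrl),
    h2.eventually (lt_mem_nhds (ENNReal.ofReal_lt_top (r := C)))] with n h4 h5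
  calc ENNReal.ofReal (c n ω) ≤ ENNReal.ofReal C := ENNReal.ofReal_le_ofReal (hc n ω)
    _ < ENNReal.ofReal (Real.sqrt n) * r := h5
    _ ≤ ENNReal.ofReal (Real.sqrt n) * b n ω := by
      gcongr
      exact h4.le.trans (tsub_le_iff_right.2 (hab n ω))

theorem integrable_norm_sub_sq_mul_rpow {P : Measure (E d × E d)} [IsProbabilityMeasure P]
    {p s : ℝ} (hs : 0 ≤ s) (hsp : 2 + s ≤ p)
    (h : MemLp (fun z : E d × E d => WithLp.toLp 2 z) (ENNReal.ofReal p) P) :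
    Integrable (fun z : E d × E d => ‖z.2 - z.1‖ ^ 2 * (1 + ‖z.1‖) ^ s) P := by
  have hp : 0 < p := by linarith
  have h1 : MemLp (fun z : E d × E d => 1 + ‖WithLp.toLp 2 z‖) (ENNReal.ofReal p) P :=
    (memLp_const (1 : ℝ)).add h.norm
  have h2 := h1.integrable_norm_rpow (by simpa using hp) ENNReal.ofReal_ne_top
  rw [ENNReal.toReal_ofReal hp.le] at h2
  refine (h2.const_mul 4).mono (by apply Measurable.aestronglyMeasurable; fun_prop)
    (ae_of_all _ fun z => ?_)
  have e1 : ‖z.1‖ ≤ ‖WithLp.toLp 2 z‖ := WithLp.norm_fst_le _ (WithLp.toLp 2 z)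
  have e2 : ‖z.2‖ ≤ ‖WithLp.toLp 2 z‖ := WithLp.norm_snd_le _ (WithLp.toLp 2 z)
  set N := ‖WithLp.toLp 2 z‖ with hN
  have hN0 : 0 ≤ N := norm_nonneg _
  have e3 : ‖z.2 - z.1‖ ≤ 2 * (1 + N) := by
    have := norm_sub_le z.2 z.1
    linarith
  rw [Real.norm_of_nonneg (by positivity), Real.norm_of_nonneg (by positivity),
    Real.norm_of_nonneg (by positivity)]
  calc ‖z.2 - z.1‖ ^ 2 * (1 + ‖z.1‖) ^ s ≤ (2 * (1 + N)) ^ 2 * (1 + N) ^ s := by gcongr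
    _ = 4 * ((1 + N) ^ (2 : ℝ) * (1 + N) ^ s) := by
      rw [Real.rpow_two]
      ring
    _ = 4 * (1 + N) ^ (2 + s) := by rw [Real.rpow_add (by positivity)]
    _ ≤ 4 * (1 + N) ^ p := by
      gcongr
      linarith

end Consistency

end MartingalePair

end

/-! ### The main theorem -/

open MartingalePair

theorem mainTheorem8 {d : ℕ} {Ω : Type*} [MeasurableSpace Ω] (μ : Measure Ω)
    [IsProbabilityMeasure μ] (P₀ : Measure (E d × E d)) [IsProbabilityMeasure P₀]
    (X Y : ℕ → Ω → E d)
    (hlaw : ∀ i, HasLaw (fun ω => (X i ω, Y i ω)) P₀ μ)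
    (hindep : iIndepFun (fun i ω => (X i ω, Y i ω)) μ)
    (γ ρ m δ : ℝ) (hγ : 1 ≤ γ) (hρ : γ + d < ρ) (hδ : 0 < δ)
    (hm : m = 2 * (γ + d + ρ * (γ - 1)) ∨
      (m = 2 * (d + 1 + ρ - (ρ - 1) / γ) ∧ γ * d + 1 < ρ))
    (hmom : MemLp (fun z : E d × E d => WithLp.toLp 2 z) (ENNReal.ofReal (m + δ)) P₀)
    (halt : 0 < P₀ {z | (P₀[(Prod.snd : E d × E d → E d) |
      MeasurableSpace.comap (Prod.fst : E d × E d → E d) inferInstance]) z ≠ z.1}) :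
    (∀ σ : ℝ, 0 < σ →
      (∀ᵐ ω ∂μ, Tendsto (fun n => smoothedMPD ρ σ (empirical (X · ω) (Y · ω) n) 1) atTop
        (𝓝 (smoothedMPD ρ σ P₀ 1))) ∧
      0 < smoothedMPD ρ σ P₀ 1 ∧ smoothedMPD ρ σ P₀ 1 < ⊤) ∧
    (∀ α σ : ℝ, 0 < α → α < 1 → 0 < σ →
      Tendsto (fun n => μ {ω | Rejects α ρ σ P₀ n (empirical (X · ω) (Y · ω) n)}) atTop
        (𝓝 1)) ∧
    (∀ (α : ℝ) (s : ℕ → Ω → ℝ) (ε : ℕ → ℝ≥0∞), 0 < α → α < 1 → Tendsto ε atTop (𝓝 0) →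
      (∀ n ω, 1 ≤ s n ω) →
      (∀ n ω (σ : ℝ), 1 ≤ σ →
        smoothedMPD ρ σ (empirical (X · ω) (Y · ω) n) 1 ≤
          smoothedMPD ρ (s n ω) (empirical (X · ω) (Y · ω) n) 1 + ε n) →
      Tendsto (fun n => μ {ω | Rejects α ρ (s n ω) P₀ n (empirical (X · ω) (Y · ω) n)}) atTop
        (𝓝 1)) := by
  have hd0 : (0 : ℝ) ≤ d := by positivity
  have hρ1 : (d : ℝ) + 1 < ρ := by linarith
  have hρ' : (d : ℝ) < ρ := by linarith
  -- Either form of m leaves a moment of order 2 + d + δ, enough for E[|Y - X|² (1 + |X|)^s] with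
  -- some s > d.
  have hm2 : 2 + (d : ℝ) ≤ m := by
    rcases hm with rfl | ⟨rfl, _⟩
    · have : 0 ≤ ρ * (γ - 1) := mul_nonneg (by linarith) (by linarith)
      linarith
    · have : (ρ - 1) / γ ≤ ρ - 1 := div_le_self (by linarith) hγ
      linarith
  have hp1 : (1 : ℝ≥0∞) ≤ ENNReal.ofReal (m + δ) := by
    rw [← ENNReal.ofReal_one]
    exact ENNReal.ofReal_le_ofReal (by linarith)
  have hI := hmom.integrable hp1
  have hX : Integrable Prod.fst P₀ := hI.norm.mono (by fun_prop)
    (ae_of_all _ fun z => by simpa using WithLp.norm_fst_le _ (WithLp.toLp 2 z))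
  have hY : Integrable Prod.snd P₀ := hI.norm.mono (by fun_prop)
    (ae_of_all _ fun z => by simpa using WithLp.norm_snd_le _ (WithLp.toLp 2 z))
  have hpos : ∀ σ : ℝ, 0 < σ → 0 < smoothedMPD ρ σ P₀ 1 := fun σ hσ => by
    rw [smoothedMPD_one_eq hρ1 hσ hX hY]
    exact lintegral_enorm_smoothedDrift_pos hρ' hσ hX hY halt
  have hconv := fun (σ : ℝ) (hσ : 0 < σ) =>
    ae_tendsto_smoothedMPD_empirical hlaw hindep hρ1 hσ hX hY
  refine ⟨fun σ hσ => ⟨hconv σ hσ, hpos σ hσ, ?_⟩, fun α σ hα hα1 hσ => ?_,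
    fun α s ε hα hα1 hε hs1 hs => ?_⟩
  · rw [smoothedMPD_one_eq hρ1 hσ hX hY]
    exact lintegral_enorm_smoothedDrift_lt_top hρ' hσ hX hY
  · exact tendsto_measure_lt_sqrt_mul (hpos σ hσ) (hconv σ hσ) tendsto_const_nhds
      (fun n ω => (add_zero _).ge) (fun n ω => le_refl (criticalValue α ρ σ P₀))
  -- The exponent s = d + min(δ, ρ - d) exceeds d, satisfies 2 + s ≤ m + δ, and is at most ρ, so
  -- that 2ρ - s ≥ ρ > d.
  · have hr1 : 0 < min δ (ρ - d) := lt_min hδ (by linarith)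
    have hr2 : min δ (ρ - d) ≤ δ := min_le_left _ _
    have hr3 : min δ (ρ - d) ≤ ρ - d := min_le_right _ _
    have hD := integrable_norm_sub_sq_mul_rpow (s := d + min δ (ρ - d)) (by linarith)
      (by linarith) hmom
    exact tendsto_measure_lt_sqrt_mul (hpos 1 one_pos) (hconv 1 one_pos) hε
      (fun n ω => hs n ω 1 le_rfl)
      (fun n ω => criticalValue_le hα hρ' (hs1 n ω) (by linarith) (by linarith) hD)
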